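/- Let $G$ be a Lie group modelled on a Hausdorff locally convex space (smoothness in the Michal–Bastiani sense), with Lie algebra $\mathfrak g$ and a smooth exponential map $\exp:\mathfrak g\to G$; assume that $\mathfrak g$ is complete. Let $\gamma:\mathbb R\to\mathrm{Aut}(G)$ be a one-parameter group of smooth automorphisms (with smooth inverses) that defines a continuous action of $\mathbb R$ on $G$, and assume that the complex linear extensions $\alpha_t:=\mathbf L(\gamma_t)_{\mathbb C}$ of the differentials $\mathbf L(\gamma_t)$ of $\gamma_t$ at $1$ define a continuous action $\alpha$ of $\mathbb R$ on the complexification $\mathfrak g_{\mathbb C}$. Let $\pi^\#(g,t)=\pi(g)U_t$ be a (strongly) continuous unitary representation of $G\rtimes_\gamma\mathbb R$ on a complex Hilbert space $\mathcal H$. Let $\mathcal H^\infty$ be the space of all $v\in\mathcal H$ with smooth orbit map $G\to\mathcal H$, $g\mapsto\pi(g)v$, and let $\mathrm d\pi(x)v=\frac{d}{dt}\big|_{t=0}\pi(\exp(tx))v$ for $x\in\mathfrak g$, $v\in\mathcal H^\infty$, extended complex linearly in $x$ to $\mathfrak g_{\mathbb C}$. A one-parameter group $(\beta_t)_{t\in\mathbb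 R}$ of continuous linear operators on a locally convex space $V$ is called equicontinuous if for every $0$-neighborhood $N_1$ in $V$ there is a $0$-neighborhood $N_2$ with $\beta_t(N_2)\subseteq N_1$ for all $t\in\mathbb R$. It is called polynomially bounded if for every continuous seminorm $p$ on $V$ there is $N\in\mathbb N_0$ such that the operators $(1+|t|^N)^{-1}\beta_t$, $t\in\mathbb R$, are equicontinuous as maps from $V$ to $(V,p)$, the space $V$ with the topology defined by $p$ alone. For $f:\mathbb R\to\mathbb C$ put $\hat f(s)=\int_{\mathbb R}f(t)e^{ist}\,dt$ and, where the integral exists, $\beta_f v=\int_{\mathbb R}f(t)\,\beta_t v\,dt$. For $V$ complex, complete and Hausdorff and $\beta$ equicontinuous and strongly continuous, put $$\mathrm{Spec}_\beta(v)=\{s\in\mathbb R:\ \hat f(s)=0\text{ for all } f\in L^1(\mathbb R)\text{ with }\beta_f v=0\},\qquad V(E)=\{v\in V:\ \mathrm{Spec}_\beta(v)\subseteq\overline E\}$$ for $v\in V$, $E\subseteq\mathbb R$. For $\beta$ only polynomially bounded (and strongly continuous), define $\mathrm{Spec}_\beta(v;\mathcal S)$ and $V(E;\mathcal S)$ in the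 same way, with $L^1(\mathbb R)$ replaced by the Schwartz space $\mathcal S(\mathbb R)$. Let $\mathfrak g_{\mathbb C}(E)$ and $\mathfrak g_{\mathbb C}(E;\mathcal S)$ be these spaces for $\alpha$ on $\mathfrak g_{\mathbb C}$, let $\mathcal H(F)$ be the space $V(F)$ for the (equicontinuous) group $U$ on $V=\mathcal H$, and put $\mathcal H^\infty(F)=\mathcal H^\infty\cap\mathcal H(F)$. (i) If $\alpha$ is equicontinuous, then for all subsets $E,F\subseteq\mathbb R$ $$\mathrm d\pi(\mathfrak g_{\mathbb C}(E))\,\mathcal H^\infty(F)\subseteq\mathcal H^\infty(E+F).$$ (ii) If $\alpha$ is polynomially bounded, then for all subsets $E,F\subseteq\mathbb R$ $$\mathrm d\pi(\mathfrak g_{\mathbb C}(E;\mathcal S))\,\mathcal H^\infty(F)\subseteq\mathcal H^\infty(E+F).$$ -/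

import Mathlib

open scoped Topology Pointwise SchwartzMap
open MeasureTheory Filter

namespace SpecTransl

noncomputable section

/-! ### Calculus in locally convex spaces -/

section Calculus

variable {V W : Type*} [AddCommGroup V] [Module ℝ V] [AddCommGroup W] [Module ℝ W]
  [TopologicalSpace W]

/-- `f` has at `x` the directional derivative `w` in the direction `h`. -/
def HasDirDeriv (f : V → W) (x h : V) (w : W) : Prop :=
  Tendsto (fun s : ℝ => s⁻¹ • (f (x + s • h) - f x)) (𝓝[≠] 0) (𝓝 w)

/-- Smoothness of `f` on an open subset `U` of a locally convex space, in the sense of Michal and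
Bastiani (Keller's `C^∞_c`): all iterated directional derivatives
`d^k f (x) (h₁, …, h_k)` exist for `x ∈ U`, and each `d^k f : U × V^k → W` is continuous. Here
`D k` is `d^k f`, with the direction of the last differentiation in the first slot. -/
def BastianiSmoothOn [TopologicalSpace V] (f : V → W) (U : Set V) : Prop :=
  ∃ D : (k : ℕ) → V → (Fin k → V) → W,
    (∀ x ∈ U, ∀ h : Fin 0 → V, D 0 x h = f x) ∧
    (∀ k : ℕ, ∀ x ∈ U, ∀ (h : Fin k → V) (y : V),
      HasDirDeriv (fun z => D k z h) x y (D (k + 1) x (Fin.cons y h : Fin (k + 1) → V))) ∧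
    (∀ k : ℕ, ContinuousOn (fun p : V × (Fin k → V) => D k p.1 p.2) (U ×ˢ Set.univ))

end Calculus

/-! ### Locally convex Lie groups

The Lie group `G` is modelled on the locally convex space `𝔤`. Its Lie algebra, the tangent space
at `1`, is identified as a topological vector space with `𝔤` through the preferred chart at `1`. -/

section LieGroup

variable (𝔤 : Type*) [AddCommGroup 𝔤] [Module ℝ 𝔤] [TopologicalSpace 𝔤]
  (G : Type*) [TopologicalSpace G] [ChartedSpace 𝔤 G] [Group G]

/-- The atlas of `G` is smooth and the group operations, which are continuous, are smooth
in charts. -/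
structure IsLocallyConvexLieGroup : Prop where
  smooth_transition : ∀ e ∈ atlas 𝔤 G, ∀ e' ∈ atlas 𝔤 G,
    BastianiSmoothOn (fun x => e' (e.symm x)) (e.symm.trans e').source
  continuous_mul : Continuous fun p : G × G => p.1 * p.2
  continuous_inv : Continuous fun g : G => g⁻¹
  smooth_mul : ∀ e₁ ∈ atlas 𝔤 G, ∀ e₂ ∈ atlas 𝔤 G, ∀ e₃ ∈ atlas 𝔤 G,
    BastianiSmoothOn (fun p : 𝔤 × 𝔤 => e₃ (e₁.symm p.1 * e₂.symm p.2))
      {p | p.1 ∈ e₁.target ∧ p.2 ∈ e₂.target ∧ e₁.symm p.1 * e₂.symm p.2 ∈ e₃.source}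
  smooth_inv : ∀ e₁ ∈ atlas 𝔤 G, ∀ e₂ ∈ atlas 𝔤 G,
    BastianiSmoothOn (fun x : 𝔤 => e₂ (e₁.symm x)⁻¹)
      {x | x ∈ e₁.target ∧ (e₁.symm x)⁻¹ ∈ e₂.source}

variable {𝔤 G}

/-- `exp` is a smooth exponential map of `G`: it is smooth, and for every `x` the map
`t ↦ exp (t x)` is a one-parameter group of `G` with velocity `x` at `t = 0`. -/
structure IsSmoothExp (exp : 𝔤 → G) : Prop where
  continuous : Continuous exp
  smooth : ∀ e ∈ atlas 𝔤 G, BastianiSmoothOn (fun x => e (exp x)) (exp ⁻¹' e.source)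
  map_add : ∀ (x : 𝔤) (s t : ℝ), exp ((s + t) • x) = exp (s • x) * exp (t • x)
  velocity : ∀ x : 𝔤, HasDirDeriv (fun z => chartAt 𝔤 (1 : G) (exp z)) 0 x x

variable (𝔤)

/-- `φ : G → G` is smooth. -/
structure IsSmoothSelfMap (φ : G → G) : Prop where
  continuous : Continuous φ
  smooth : ∀ e ∈ atlas 𝔤 G, ∀ e' ∈ atlas 𝔤 G,
    BastianiSmoothOn (fun x => e' (φ (e.symm x))) {x | x ∈ e.target ∧ φ (e.symm x) ∈ e'.source}

/-- The automorphism `φ` of `G` is smooth, with smooth inverse. -/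
def IsLieAut (φ : MulAut G) : Prop :=
  IsSmoothSelfMap 𝔤 (fun g => φ g) ∧ IsSmoothSelfMap 𝔤 (fun g => φ⁻¹ g)

variable {𝔤}

/-- `L(φ) : 𝔤 → 𝔤`, the differential at `1` of the automorphism `φ` of `G`. -/
def lieMap (φ : MulAut G) (x : 𝔤) : 𝔤 :=
  limUnder (𝓝[≠] (0 : ℝ)) fun s =>
    s⁻¹ • (chartAt 𝔤 (1 : G) (φ ((chartAt 𝔤 (1 : G)).symm (chartAt 𝔤 (1 : G) 1 + s • x)))
      - chartAt 𝔤 (1 : G) 1)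

end LieGroup

/-! ### Complexification -/

/-- The complexification `𝔤_ℂ = 𝔤 ⊕ i𝔤`; the pair `(x, y)` stands for `x + iy`. -/
def Complexification (𝔤 : Type*) : Type _ := 𝔤 × 𝔤

namespace Complexification

variable {𝔤 : Type*}

/-- The real part. -/
def re (y : Complexification 𝔤) : 𝔤 := y.1

/-- The imaginary part. -/
def im (y : Complexification 𝔤) : 𝔤 := y.2

/-- The element `a + ib`. -/
def mk (a b : 𝔤) : Complexification 𝔤 := (a, b)

instance [TopologicalSpace 𝔤] : TopologicalSpace (Complexification 𝔤) :=
  inferInstanceAs (TopologicalSpace (𝔤 × 𝔤))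

instance [AddCommGroup 𝔤] : AddCommGroup (Complexification 𝔤) :=
  inferInstanceAs (AddCommGroup (𝔤 × 𝔤))

theorem ext' {x y : Complexification 𝔤} (h₁ : x.re = y.re) (h₂ : x.im = y.im) : x = y :=
  Prod.ext h₁ h₂

variable [AddCommGroup 𝔤]

theorem re_add (x y : Complexification 𝔤) : (x + y).re = x.re + y.re := rfl
theorem im_add (x y : Complexification 𝔤) : (x + y).im = x.im + y.im := rfl
theorem re_zero : (0 : Complexification 𝔤).re = 0 := rfl
theorem im_zero : (0 : Complexification 𝔤).im = 0 := rfl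

variable [Module ℝ 𝔤]

instance : SMul ℂ (Complexification 𝔤) :=
  ⟨fun z y => mk (z.re • y.re - z.im • y.im) (z.re • y.im + z.im • y.re)⟩

theorem re_smul (z : ℂ) (y : Complexification 𝔤) :
    (z • y).re = z.re • y.re - z.im • y.im := rfl
theorem im_smul (z : ℂ) (y : Complexification 𝔤) :
    (z • y).im = z.re • y.im + z.im • y.re := rfl

instance : Module ℂ (Complexification 𝔤) where
  one_smul y := by apply ext' <;> simp [re_smul, im_smul]
  mul_smul z w y := by
    apply ext' <;> simp only [re_smul, im_smul, Complex.mul_re, Complex.mul_im] <;> module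
  smul_zero z := by apply ext' <;> simp [re_smul, im_smul, re_zero, im_zero]
  smul_add z x y := by
    apply ext' <;> simp only [re_smul, im_smul, re_add, im_add] <;> module
  add_smul z w y := by
    apply ext' <;> simp only [re_smul, im_smul, re_add, im_add, Complex.add_re, Complex.add_im]
      <;> module
  zero_smul y := by apply ext' <;> simp [re_smul, im_smul, re_zero, im_zero]

end Complexification

/-! ### Arveson spectral theory -/

section Arveson

variable {V : Type*} [AddCommGroup V] [Module ℂ V] [TopologicalSpace V]

/-- The set `{α_t}` is equicontinuous. -/
def IsEquicontinuous (α : ℝ → V → V) : Prop :=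
  ∀ U ∈ 𝓝 (0 : V), ∃ W ∈ 𝓝 (0 : V), ∀ t : ℝ, ∀ x ∈ W, α t x ∈ U

/-- `α` is polynomially bounded: for every continuous seminorm `p` there is `N` such that
the maps `(1 + |t|^N)⁻¹ α_t`, from `V` to `V` with the topology of `p`, are equicontinuous. -/
def IsPolynomiallyBounded (α : ℝ → V → V) : Prop :=
  ∀ p : Seminorm ℂ V, Continuous p → ∃ N : ℕ, ∀ ε > (0 : ℝ), ∃ W ∈ 𝓝 (0 : V),
    ∀ t : ℝ, ∀ x ∈ W, p ((((1 + |t| ^ N)⁻¹ : ℝ) : ℂ) • α t x) < ε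

/-- `I` is the integral over `ℝ` of the `V`-valued function `u`, in the weak sense. (In a Hausdorff
locally convex space there is at most one such `I`.) -/
def HasWeakIntegral (u : ℝ → V) (I : V) : Prop :=
  ∀ l : V →L[ℂ] ℂ, Integrable (fun t => l (u t)) ∧ ∫ t, l (u t) = l I

/-- The Fourier transform `f^(s) = ∫ f(t) e^{ist} dt`. -/
def hat (f : ℝ → ℂ) (s : ℝ) : ℂ := ∫ t : ℝ, f t * Complex.exp (Complex.I * s * t)

/-- The integrable functions on `ℝ`. -/
def L1Functions : Set (ℝ → ℂ) := {f | Integrable f}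

/-- The Schwartz functions on `ℝ`. -/
def SchwartzFunctions : Set (ℝ → ℂ) := Set.range fun f : 𝓢(ℝ, ℂ) => (f : ℝ → ℂ)

/-- The spectrum of `v` with respect to `α` and the class `A` of functions: the common zeros of the
Fourier transforms of all `f ∈ A` with `α_f v = ∫ f(t) α_t(v) dt = 0`. With `A` the integrable
functions this is `Spec_α(v)`, with `A` the Schwartz functions it is `Spec_α(v; 𝓢)`. -/
def arvesonSpec (A : Set (ℝ → ℂ)) (α : ℝ → V → V) (v : V) : Set ℝ :=
  {s | ∀ f ∈ A, HasWeakIntegral (fun t => f t • α t v) 0 → hat f s = 0}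

/-- The Arveson spectral subspace `V(E)` (`A` the integrable functions), respectively
`V(E; 𝓢)` (`A` the Schwartz functions). -/
def spectralSubspace (A : Set (ℝ → ℂ)) (α : ℝ → V → V) (E : Set ℝ) : Set V :=
  {v | arvesonSpec A α v ⊆ closure E}

end Arveson

/-! ### Unitary representations -/

section Representation

variable {𝔤 : Type*} [AddCommGroup 𝔤] [Module ℝ 𝔤] [TopologicalSpace 𝔤]
  {G : Type*} [TopologicalSpace G] [ChartedSpace 𝔤 G] [Group G]
  {H : Type*} [NormedAddCommGroup H] [InnerProductSpace ℂ H]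

/-- `α_t = L(γ_t)_ℂ`, the complex linear extension of `L(γ_t)`. -/
def complexAction (𝔤 : Type*) [AddCommGroup 𝔤] [Module ℝ 𝔤] [TopologicalSpace 𝔤]
    {G : Type*} [TopologicalSpace G] [ChartedSpace 𝔤 G] [Group G]
    (γ : Multiplicative ℝ →* MulAut G) (t : ℝ) (y : Complexification 𝔤) : Complexification 𝔤 :=
  Complexification.mk (lieMap (γ (Multiplicative.ofAdd t)) y.re)
    (lieMap (γ (Multiplicative.ofAdd t)) y.im)

variable {γ : Multiplicative ℝ →* MulAut G}

/-- Continuity of a unitary representation of `G ⋊_γ ℝ`, which carries the product topology. -/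
def IsContinuousUnitaryRep (ρ : G ⋊[γ] Multiplicative ℝ →* (H ≃ₗᵢ[ℂ] H)) : Prop :=
  ∀ v : H, Continuous fun p : G × ℝ => ρ ⟨p.1, Multiplicative.ofAdd p.2⟩ v

/-- The restriction `π` to `G`, `π(g) = ρ(g, 0)`. -/
def repG (ρ : G ⋊[γ] Multiplicative ℝ →* (H ≃ₗᵢ[ℂ] H)) : G →* (H ≃ₗᵢ[ℂ] H) :=
  ρ.comp SemidirectProduct.inl

/-- The unitary one-parameter group `U_t = ρ(1, t)`. -/
def repU (ρ : G ⋊[γ] Multiplicative ℝ →* (H ≃ₗᵢ[ℂ] H)) (t : ℝ) (v : H) : H :=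
  ρ (SemidirectProduct.inr (Multiplicative.ofAdd t)) v

/-- The set `H^∞` of smooth vectors: those with smooth orbit map `g ↦ π(g) v`. -/
def smoothVectors (𝔤 : Type*) [AddCommGroup 𝔤] [Module ℝ 𝔤] [TopologicalSpace 𝔤]
    {G : Type*} [TopologicalSpace G] [ChartedSpace 𝔤 G] [Group G]
    (π : G →* (H ≃ₗᵢ[ℂ] H)) : Set H :=
  {v | ∀ e ∈ atlas 𝔤 G, BastianiSmoothOn (fun x : 𝔤 => π (e.symm x) v) e.target}

/-- `dπ(x) v = d/dt|₀ π(exp (t x)) v` for `x ∈ 𝔤`. -/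
def dRepReal (exp : 𝔤 → G) (π : G →* (H ≃ₗᵢ[ℂ] H)) (x : 𝔤) (v : H) : H :=
  deriv (fun t : ℝ => π (exp (t • x)) v) 0

/-- The complex linear extension `dπ(a + ib) v = dπ(a) v + i dπ(b) v`. -/
def dRep (exp : 𝔤 → G) (π : G →* (H ≃ₗᵢ[ℂ] H)) (y : Complexification 𝔤) (v : H) : H :=
  dRepReal exp π y.re v + Complex.I • dRepReal exp π y.im v

/-- `H^∞(F) = H^∞ ∩ H(F)`, with `H(F)` the Arveson spectral subspace of `U`. -/
def smoothSpectralSubspace (𝔤 : Type*) [AddCommGroup 𝔤] [Module ℝ 𝔤] [TopologicalSpace 𝔤]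
    {G : Type*} [TopologicalSpace G] [ChartedSpace 𝔤 G] [Group G]
    {γ : Multiplicative ℝ →* MulAut G}
    (ρ : G ⋊[γ] Multiplicative ℝ →* (H ≃ₗᵢ[ℂ] H)) (F : Set ℝ) : Set H :=
  smoothVectors 𝔤 (repG ρ) ∩ spectralSubspace L1Functions (repU ρ) F

end Representation

end

end SpecTransl

/-! Fix smooth vectors `u`, `v` and put `w = dπ(y)v`. Unitarity and covariance, U_t π(g) = π(γ_t(g))
U_t, move the unbounded operator onto the fixed vector `u`: ⟨u, U_t w⟩ = ⟨T(α_t y), U_t v⟩ with `T`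
continuous and antilinear, depending only on `u`. This is the restriction to the diagonal of Φ(s, t)
= ⟨T(α_s y), U_t v⟩, which has spectrum in the closure of `E` as a function of `s` and in the
closure of `F` as a function of `t`. The theorem is therefore a statement about scalar functions:
the spectrum of t ↦ Φ(t, t) lies in the closure of E + F (`FourierVanishes.diagonal`).

Scalar spectra are handled distributionally. `FourierVanishes φ O` says that φ annihilates 𝓕 k for
every test function `k` supported in `O`; this is a local condition (`FourierVanishes.of_local`). An
annihilator `f` with nonzero transform at ξ forces vanishing near ξ. If `f` is Schwartz, one divides
`k` by 𝓕⁻ f. If `f` is only integrable, that quotient need not be smooth; instead φ is bounded, and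
its part of frequency near ξ is so close to a character that annihilation by `f` contracts its
supremum by a factor 1/2 (`FourierVanishes.of_integrable`). This is the only place where the two
cases of the theorem differ in substance.

To return to `H`, choose `k` equal to 1 at a point off the closure of E + F and supported off that
closure. The vector I = ∫ 𝓕 k(t) U_t w dt is orthogonal to all smooth vectors, in particular to
every U_t w, hence to itself; no density of the smooth vectors is needed. So 𝓕 k annihilates `w`,
while its inverse transform is 1 at the chosen point.

The remaining input is Michal–Bastiani calculus: dπ(y) and U_t preserve smooth vectors, and x ↦
dπ(x)u and L(γ_t) are continuous linear. It is developed through a recursive notion of finite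
differentiability, `IsBastianiC`, for which the chain rule is a short induction. -/

namespace SpecTransl

/-! ### Distributional Fourier support of functions of polynomial growth. -/

section Harmonic

open scoped FourierTransform ContDiff
open FourierTransform

/-- Continuous functions of polynomial growth. -/
structure IsPolyGrowth (φ : ℝ → ℂ) : Prop where
  continuous : Continuous φ
  bound : ∃ (C : ℝ) (N : ℕ), ∀ t, ‖φ t‖ ≤ C * (1 + |t|) ^ N

/-- The distributional Fourier transform of `φ` vanishes on `O`. -/
def FourierVanishes (φ : ℝ → ℂ) (O : Set ℝ) : Prop :=
  ∀ k : 𝓢(ℝ, ℂ), HasCompactSupport k → tsupport k ⊆ O → ∫ t, 𝓕 k t * φ t = 0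

theorem FourierVanishes.mono {φ : ℝ → ℂ} {O O' : Set ℝ} (h : FourierVanishes φ O)
    (hO : O' ⊆ O) : FourierVanishes φ O' :=
  fun k hk hs => h k hk (hs.trans hO)

theorem integrable_one_add_pow_mul_norm (A : 𝓢(ℝ, ℂ)) (N : ℕ) :
    Integrable fun t : ℝ => (1 + |t|) ^ N * ‖A t‖ := by
  have h : (fun t : ℝ => (1 + |t|) ^ N * ‖A t‖) = fun t : ℝ =>
      ∑ m ∈ Finset.range (N + 1), (N.choose m : ℝ) * (‖t‖ ^ m * ‖A t‖) := by
    ext t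
    rw [add_comm, add_pow, Finset.sum_mul]
    refine Finset.sum_congr rfl fun m _ => ?_
    simp only [one_pow, mul_one, Real.norm_eq_abs]
    ring
  rw [h]
  exact integrable_finsetSum _ fun m _ => (A.integrable_pow_mul volume m).const_mul _

theorem IsPolyGrowth.integrable_mul {φ : ℝ → ℂ} (hφ : IsPolyGrowth φ) (A : 𝓢(ℝ, ℂ)) :
    Integrable fun t => A t * φ t := by
  obtain ⟨C, N, hC⟩ := hφ.bound
  refine ((integrable_one_add_pow_mul_norm A N).const_mul C).mono'
    (A.continuous.mul hφ.continuous).aestronglyMeasurable (ae_of_all _ fun t => ?_)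
  rw [norm_mul]
  calc ‖A t‖ * ‖φ t‖ ≤ ‖A t‖ * (C * (1 + |t|) ^ N) := by gcongr; exact hC t
    _ = _ := by ring

theorem one_add_abs_add_pow_le (s t : ℝ) (N : ℕ) :
    (1 + |s + t|) ^ N ≤ (1 + |s|) ^ N * (1 + |t|) ^ N := by
  rw [← mul_pow]
  refine pow_le_pow_left₀ (by positivity) ?_ N
  nlinarith [abs_add_le s t, mul_nonneg (abs_nonneg s) (abs_nonneg t)]

theorem IsPolyGrowth.translate {φ : ℝ → ℂ} (hφ : IsPolyGrowth φ) (r : ℝ) :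
    IsPolyGrowth fun t => φ (t + r) := by
  obtain ⟨C, N, hC⟩ := hφ.bound
  have hC0 : 0 ≤ C := by simpa using (norm_nonneg _).trans (hC 0)
  refine ⟨hφ.continuous.comp (by fun_prop), C * (1 + |r|) ^ N, N, fun t => (hC _).trans ?_⟩
  calc C * (1 + |t + r|) ^ N ≤ C * ((1 + |t|) ^ N * (1 + |r|) ^ N) := by
        gcongr; exact one_add_abs_add_pow_le t r N
    _ = _ := by ring

theorem integrable_mul_mul_sub (A B : 𝓢(ℝ, ℂ)) {Ψ : ℝ × ℝ → ℂ} (hΨ : Continuous Ψ) {C : ℝ} {N : ℕ}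
    (hC : ∀ p : ℝ × ℝ, ‖Ψ p‖ ≤ C * ((1 + |p.1|) ^ N * (1 + |p.2 - p.1|) ^ N)) :
    Integrable (fun p : ℝ × ℝ => A p.1 * B (p.2 - p.1) * Ψ p) (volume.prod volume) := by
  have h := ((integrable_one_add_pow_mul_norm A N).convolution_integrand
    (ContinuousLinearMap.mul ℝ ℝ) (integrable_one_add_pow_mul_norm B N)).swap
  refine (h.const_mul C).mono' (Continuous.aestronglyMeasurable ?_) (ae_of_all _ fun p => ?_)
  · have := A.continuous
    have := B.continuous
    fun_prop
  · simp only [Function.comp_apply, Prod.fst_swap, Prod.snd_swap, ContinuousLinearMap.mul_apply',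
      norm_mul]
    calc ‖A p.1‖ * ‖B (p.2 - p.1)‖ * ‖Ψ p‖
        ≤ ‖A p.1‖ * ‖B (p.2 - p.1)‖ * (C * ((1 + |p.1|) ^ N * (1 + |p.2 - p.1|) ^ N)) := by
          gcongr; exact hC p
      _ = _ := by ring

/-- The product of two Schwartz functions. -/
noncomputable def schwartzMul (a b : 𝓢(ℝ, ℂ)) : 𝓢(ℝ, ℂ) :=
  SchwartzMap.pairing (ContinuousLinearMap.mul ℂ ℂ) a b

theorem schwartzMul_apply (a b : 𝓢(ℝ, ℂ)) (x : ℝ) : schwartzMul a b x = a x * b x := rfl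

theorem fourier_schwartzMul_apply (a b : 𝓢(ℝ, ℂ)) (t : ℝ) :
    𝓕 (schwartzMul a b) t = ∫ s, 𝓕 a s * 𝓕 b (t - s) := by
  have h1 : schwartzMul a b
      = 𝓕⁻ (SchwartzMap.convolution (ContinuousLinearMap.mul ℂ ℂ) (𝓕 a) (𝓕 b)) := by
    ext x
    have key : ∀ g : 𝓢(ℝ, ℂ), 𝓕⁻ g x = 𝓕 g (-x) := fun g => by
      rw [SchwartzMap.fourierInv_coe, SchwartzMap.fourier_coe, Real.fourierInv_eq_fourier_neg]
    rw [key, SchwartzMap.fourier_convolution, SchwartzMap.pairing_apply_apply, ← key, ← key]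
    simp [schwartzMul_apply]
  rw [h1, FourierTransform.fourier_fourierInv_eq, SchwartzMap.convolution_apply]
  rfl

/-- Fubini applied to 𝓕(ab) = 𝓕 a * 𝓕 b. The inner integral pairs 𝓕 b with a translate of φ, so a
`b` annihilating all translates makes every multiple of `b` annihilate φ. -/
theorem integral_fourier_schwartzMul {φ : ℝ → ℂ} (hφ : IsPolyGrowth φ) (a b : 𝓢(ℝ, ℂ)) :
    ∫ t, 𝓕 (schwartzMul a b) t * φ t = ∫ s, 𝓕 a s * ∫ t, 𝓕 b t * φ (t + s) := by
  obtain ⟨C, N, hC⟩ := hφ.bound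
  have hC0 : 0 ≤ C := by simpa using (norm_nonneg _).trans (hC 0)
  have hint : Integrable (fun p : ℝ × ℝ => 𝓕 a p.1 * 𝓕 b (p.2 - p.1) * φ p.2)
      (volume.prod volume) :=
    integrable_mul_mul_sub (𝓕 a) (𝓕 b) (Ψ := fun p => φ p.2)
      (hφ.continuous.comp continuous_snd) (C := C) (N := N) fun p => by
        refine (hC p.2).trans ?_
        gcongr
        simpa using one_add_abs_add_pow_le p.1 (p.2 - p.1) N
  calc ∫ t, 𝓕 (schwartzMul a b) t * φ t = ∫ t, ∫ s, 𝓕 a s * 𝓕 b (t - s) * φ t := by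
        simp_rw [fourier_schwartzMul_apply, integral_mul_const]
    _ = ∫ s, ∫ t, 𝓕 a s * 𝓕 b (t - s) * φ t :=
        (integral_integral_swap (f := fun s t => 𝓕 a s * 𝓕 b (t - s) * φ t) hint).symm
    _ = _ := by
        refine integral_congr_ae (ae_of_all _ fun s => ?_)
        simp only [mul_assoc]
        rw [integral_const_mul, ← integral_add_right_eq_self (μ := volume)
          (fun t => 𝓕 b (t - s) * φ t) s]
        simp

/-- Multiplication of a compactly supported Schwartz function by a character. -/
noncomputable def modulate (r : ℝ) (k : 𝓢(ℝ, ℂ)) (hk : HasCompactSupport k) : 𝓢(ℝ, ℂ) :=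
  HasCompactSupport.toSchwartzMap
    (f := fun ξ : ℝ => Complex.exp (2 * Real.pi * r * ξ * Complex.I) * k ξ) hk.mul_left (by
      refine ContDiff.mul ?_ (k.smooth ⊤)
      have : ContDiff ℝ ∞ fun ξ : ℝ => (ξ : ℂ) := Complex.ofRealCLM.contDiff
      fun_prop)

theorem modulate_apply (r : ℝ) (k : 𝓢(ℝ, ℂ)) (hk : HasCompactSupport k) (ξ : ℝ) :
    modulate r k hk ξ = Complex.exp (2 * Real.pi * r * ξ * Complex.I) * k ξ := rfl

theorem support_modulate (r : ℝ) (k : 𝓢(ℝ, ℂ)) (hk : HasCompactSupport k) :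
    Function.support (modulate r k hk) = Function.support k := by
  ext ξ
  simp [modulate_apply, Complex.exp_ne_zero]

theorem fourier_apply_eq (k : 𝓢(ℝ, ℂ)) (t : ℝ) :
    𝓕 k t = ∫ ξ : ℝ, Complex.exp (-(2 * Real.pi * t * ξ * Complex.I)) * k ξ := by
  rw [SchwartzMap.fourier_coe, Real.fourier_eq']
  refine integral_congr_ae (ae_of_all _ fun ξ => ?_)
  simp only [smul_eq_mul, RCLike.inner_apply, conj_trivial]
  congr 2
  push_cast
  ring

theorem fourier_modulate (r : ℝ) (k : 𝓢(ℝ, ℂ)) (hk : HasCompactSupport k) (t : ℝ) :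
    𝓕 (modulate r k hk) t = 𝓕 k (t - r) := by
  rw [fourier_apply_eq, fourier_apply_eq]
  refine integral_congr_ae (ae_of_all _ fun ξ => ?_)
  simp only [modulate_apply, ← mul_assoc, ← Complex.exp_add]
  congr 2
  push_cast
  ring

theorem hasCompactSupport_modulate (r : ℝ) (k : 𝓢(ℝ, ℂ)) (hk : HasCompactSupport k) :
    HasCompactSupport (modulate r k hk) := by
  rw [HasCompactSupport, tsupport, support_modulate]
  exact hk

/-- Translating φ amounts to multiplying the test function by a character, which leaves its support
unchanged. -/
theorem FourierVanishes.translate {φ : ℝ → ℂ} {O : Set ℝ} (h : FourierVanishes φ O) (r : ℝ) :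
    FourierVanishes (fun t => φ (t + r)) O := by
  intro k hk hs
  rw [← integral_sub_right_eq_self (μ := volume) _ r]
  simp only [sub_add_cancel, ← fourier_modulate r k hk]
  refine h _ (hasCompactSupport_modulate r k hk) ?_
  rwa [tsupport, support_modulate]

/-- The reflection `ξ ↦ k (-ξ)` of a Schwartz function. -/
noncomputable def reflect (k : 𝓢(ℝ, ℂ)) : 𝓢(ℝ, ℂ) :=
  SchwartzMap.compCLMOfContinuousLinearEquiv ℂ (ContinuousLinearEquiv.neg ℝ) k

theorem reflect_apply (k : 𝓢(ℝ, ℂ)) (ξ : ℝ) : reflect k ξ = k (-ξ) := rfl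

theorem fourier_reflect (k : 𝓢(ℝ, ℂ)) (t : ℝ) : 𝓕 (reflect k) t = 𝓕 k (-t) := by
  rw [fourier_apply_eq, fourier_apply_eq, ← integral_neg_eq_self]
  simp [reflect_apply]

/-- On the set where 𝓕⁻ f has no zero, a test function `k` factors as (k / 𝓕⁻ f) · 𝓕⁻ f with a
smooth compactly supported quotient, and the second factor has transform `f`. -/
theorem FourierVanishes.of_schwartz {φ : ℝ → ℂ} (hφ : IsPolyGrowth φ) (f : 𝓢(ℝ, ℂ))
    (hf : ∀ r, ∫ t, f t * φ (t + r) = 0) : FourierVanishes φ {ξ | 𝓕⁻ f ξ ≠ 0} := by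
  intro k hk hs
  -- Off the support of `k` the quotient is locally 0, whatever the zeros of 𝓕⁻ f there.
  have hsm : ContDiff ℝ ∞ fun ξ => k ξ / 𝓕⁻ f ξ := by
    rw [contDiff_iff_contDiffAt]
    intro ξ
    by_cases hξ : ξ ∈ tsupport k
    · simp only [div_eq_mul_inv]
      exact (k.contDiffAt ⊤).mul (((𝓕⁻ f).contDiffAt ⊤).inv (hs hξ))
    · refine contDiffAt_const (c := (0 : ℂ)) |>.congr_of_eventuallyEq ?_
      filter_upwards [notMem_tsupport_iff_eventuallyEq.1 hξ] with x hx
      simp [hx]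
  have hcs : HasCompactSupport fun ξ => k ξ / 𝓕⁻ f ξ := by
    simp only [div_eq_mul_inv]
    exact hk.mul_right
  set m : 𝓢(ℝ, ℂ) := hcs.toSchwartzMap hsm with hm
  have hkm : k = schwartzMul m (𝓕⁻ f) := by
    ext ξ
    have : m ξ = k ξ / 𝓕⁻ f ξ := rfl
    rw [schwartzMul_apply, this]
    by_cases hξ : k ξ = 0
    · simp [hξ]
    · rw [div_mul_cancel₀]
      exact hs (subset_tsupport _ hξ)
  rw [hkm, integral_fourier_schwartzMul hφ]
  simp [hf]

theorem fourier_sum {ι : Type*} (s : Finset ι) (κ : ι → 𝓢(ℝ, ℂ)) :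
    𝓕 (∑ i ∈ s, κ i) = ∑ i ∈ s, 𝓕 (κ i) :=
  map_sum (SchwartzMap.fourierTransformCLM ℂ (V := ℝ) (E := ℂ)) κ s

/-- A smooth partition of unity splits a test function into pieces, each supported where vanishing
is known; compactness of the support makes the sum finite. -/
theorem FourierVanishes.of_local {φ : ℝ → ℂ} (hφ : IsPolyGrowth φ) {O : Set ℝ}
    (h : ∀ ξ ∈ O, ∃ U ∈ 𝓝 ξ, FourierVanishes φ U) : FourierVanishes φ O := by
  intro k hk hs
  choose! U hU hUv using h
  obtain ⟨ρ, hρ⟩ := SmoothPartitionOfUnity.exists_isSubordinate (modelWithCornersSelf ℝ ℝ)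
    (isClosed_tsupport k) (fun x : tsupport k => interior (U x)) (fun x => isOpen_interior)
    (fun x hx => Set.mem_iUnion.2 ⟨⟨x, hx⟩, mem_interior_iff_mem_nhds.2 (hU x (hs hx))⟩)
  have hfin : {i | (Function.support (ρ i) ∩ tsupport k).Nonempty}.Finite :=
    ρ.locallyFinite.finite_nonempty_inter_compact hk
  have hsm : ∀ i, ContDiff ℝ ∞ fun ξ => ((ρ i ξ : ℝ) : ℂ) * k ξ := fun i =>
    (Complex.ofRealCLM.contDiff.comp (ρ i).contMDiff.contDiff).mul (k.smooth ⊤)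
  have hcs : ∀ i, HasCompactSupport fun ξ => ((ρ i ξ : ℝ) : ℂ) * k ξ := fun i => hk.mul_left
  let κ : tsupport k → 𝓢(ℝ, ℂ) := fun i => (hcs i).toSchwartzMap (hsm i)
  have hκ : ∀ i ξ, κ i ξ = ((ρ i ξ : ℝ) : ℂ) * k ξ := fun i ξ => rfl
  have hsum : k = ∑ i ∈ hfin.toFinset, κ i := by
    ext ξ
    rw [sum_apply]
    simp only [hκ, ← Finset.sum_mul, ← Complex.ofReal_sum]
    by_cases hξ : k ξ = 0
    · simp [hξ]
    have hξ' : ξ ∈ tsupport k := subset_tsupport _ hξ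
    have h1 := ρ.sum_eq_one hξ'
    rw [finsum_eq_sum_of_support_subset (s := hfin.toFinset)] at h1
    · rw [h1]; simp
    · intro i hi
      simp only [Set.Finite.coe_toFinset, Set.mem_ofPred_eq]
      exact ⟨ξ, hi, hξ'⟩
  rw [hsum, fourier_sum]
  simp only [sum_apply, Finset.sum_mul]
  rw [integral_finsetSum _ fun i _ => hφ.integrable_mul _]
  refine Finset.sum_eq_zero fun i _ => hUv i (hs i.2) _ (hcs i) ?_
  refine subset_trans ?_ ((hρ i).trans interior_subset)
  refine closure_mono fun ξ hξ => ?_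
  rw [Function.mem_support, hκ] at hξ
  simpa using left_ne_zero_of_mul hξ

end Harmonic

/-! ### Approximate identities and L¹ continuity of translations. -/

section Wiener

open scoped FourierTransform ContDiff
open FourierTransform

/-- The function `ξ ↦ q (c⁻¹ (ξ - ξ₀))`. -/
noncomputable def rescale (c ξ₀ : ℝ) (hc : 0 < c) (q : 𝓢(ℝ, ℂ)) : 𝓢(ℝ, ℂ) :=
  SchwartzMap.compSubConstCLM ℂ ξ₀ (SchwartzMap.compCLMOfContinuousLinearEquiv ℂ
    (ContinuousLinearEquiv.smulLeft (Units.mk0 c⁻¹ (inv_ne_zero hc.ne'))) q)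

theorem rescale_apply (c ξ₀ : ℝ) (hc : 0 < c) (q : 𝓢(ℝ, ℂ)) (ξ : ℝ) :
    rescale c ξ₀ hc q ξ = q (c⁻¹ * (ξ - ξ₀)) := rfl

theorem fourier_rescale (c ξ₀ : ℝ) (hc : 0 < c) (q : 𝓢(ℝ, ℂ)) (t : ℝ) :
    𝓕 (rescale c ξ₀ hc q) t
      = c * Complex.exp (-(2 * Real.pi * t * ξ₀ * Complex.I)) * 𝓕 q (c * t) := by
  rw [fourier_apply_eq, fourier_apply_eq, ← integral_add_right_eq_self (μ := volume) _ ξ₀]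
  simp only [rescale_apply, add_sub_cancel_right]
  have h := Measure.integral_comp_mul_left (F := ℂ) (fun η : ℝ =>
    Complex.exp (-(2 * Real.pi * t * ((c * η + ξ₀ : ℝ) : ℂ) * Complex.I)) * q η) c⁻¹
  simp only [mul_inv_cancel_left₀ hc.ne', inv_inv, abs_of_pos hc] at h
  rw [h, Complex.real_smul, mul_assoc (c : ℂ)]
  congr 1
  rw [← integral_const_mul]
  refine integral_congr_ae (ae_of_all _ fun η => ?_)
  simp only [← mul_assoc, ← Complex.exp_add]
  congr 2
  push_cast
  ring

/-- A compactly supported Schwartz function that is `1` near `0`. -/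
noncomputable def plateau : 𝓢(ℝ, ℂ) :=
  let b : ContDiffBump (0 : ℝ) := ⟨1, 2, one_pos, one_lt_two⟩
  HasCompactSupport.toSchwartzMap (f := fun ξ => ((b ξ : ℝ) : ℂ))
    (b.hasCompactSupport.comp_left Complex.ofReal_zero)
    (Complex.ofRealCLM.contDiff.comp b.contDiff)

theorem plateau_eq_one {ξ : ℝ} (h : |ξ| ≤ 1) : plateau ξ = 1 := by
  let b : ContDiffBump (0 : ℝ) := ⟨1, 2, one_pos, one_lt_two⟩
  have : b ξ = 1 := b.one_of_mem_closedBall (by simpa [b] using h)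
  change ((b ξ : ℝ) : ℂ) = 1
  simp [this]

theorem plateau_eq_zero {ξ : ℝ} (h : 2 ≤ |ξ|) : plateau ξ = 0 := by
  let b : ContDiffBump (0 : ℝ) := ⟨1, 2, one_pos, one_lt_two⟩
  have : b ξ = 0 := b.zero_of_le_dist (by simpa [b] using h)
  change ((b ξ : ℝ) : ℂ) = 0
  simp [this]

theorem tsupport_rescale_plateau_subset (c ξ₀ : ℝ) (hc : 0 < c) :
    tsupport (rescale c ξ₀ hc plateau) ⊆ Metric.closedBall ξ₀ (2 * c) := by
  refine closure_minimal (fun ξ hξ => ?_) Metric.isClosed_closedBall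
  rw [Metric.mem_closedBall, Real.dist_eq]
  by_contra! hlt
  refine hξ ?_
  rw [rescale_apply]
  refine plateau_eq_zero ?_
  rw [abs_mul, abs_inv, abs_of_pos hc, inv_mul_eq_div, le_div_iff₀ hc]
  exact hlt.le

theorem hasCompactSupport_rescale_plateau (c ξ₀ : ℝ) (hc : 0 < c) :
    HasCompactSupport (rescale c ξ₀ hc plateau) :=
  (isCompact_closedBall ξ₀ (2 * c)).of_isClosed_subset (isClosed_tsupport _)
    (tsupport_rescale_plateau_subset c ξ₀ hc)

theorem rescale_plateau_eq_one {c ξ₀ : ℝ} (hc : 0 < c) {ξ : ℝ} (h : |ξ - ξ₀| ≤ c) :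
    rescale c ξ₀ hc plateau ξ = 1 := by
  rw [rescale_apply]
  refine plateau_eq_one ?_
  rw [abs_mul, abs_inv, abs_of_pos hc, inv_mul_eq_div]
  exact div_le_one_of_le₀ h hc.le

/-- Test functions equal to 1 on growing intervals have transforms forming an approximate identity
at 0, so the vanishing pairings converge to φ(0). Polynomial growth of φ provides the domination. -/
theorem FourierVanishes.apply_zero_eq_zero {φ : ℝ → ℂ} (hφ : IsPolyGrowth φ)
    (h : FourierVanishes φ Set.univ) : φ 0 = 0 := by
  obtain ⟨C, N, hC⟩ := hφ.bound
  have hC0 : 0 ≤ C := by simpa using (norm_nonneg _).trans (hC 0)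
  have hzero : ∀ n : ℕ, ∫ t, 𝓕 plateau t * φ (((n : ℝ) + 1)⁻¹ * t) = 0 := by
    intro n
    have hn : (0 : ℝ) < (n : ℝ) + 1 := by positivity
    have h1 := h _ (hasCompactSupport_rescale_plateau _ 0 hn) (Set.subset_univ _)
    simp only [fourier_rescale] at h1
    have h2 := Measure.integral_comp_mul_left
      (fun t => 𝓕 plateau t * φ (((n : ℝ) + 1)⁻¹ * t)) ((n : ℝ) + 1)
    simp only [inv_mul_cancel_left₀ hn.ne'] at h2
    have h3 : ∫ t, 𝓕 plateau (((n : ℝ) + 1) * t) * φ t = 0 := by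
      simp only [Complex.ofReal_zero, mul_zero, zero_mul, neg_zero, Complex.exp_zero, mul_one,
        mul_assoc, integral_const_mul] at h1
      exact (mul_eq_zero.1 h1).resolve_left (by exact_mod_cast hn.ne')
    rw [h3] at h2
    exact (smul_eq_zero.1 h2.symm).resolve_left (by positivity)
  have hlim : Tendsto (fun n : ℕ => ∫ t, 𝓕 plateau t * φ (((n : ℝ) + 1)⁻¹ * t)) atTop
      (𝓝 (∫ t, 𝓕 plateau t * φ 0)) := by
    refine tendsto_integral_of_dominated_convergence
      (fun t => C * ((1 + |t|) ^ N * ‖𝓕 plateau t‖)) (fun n => ?_)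
      ((integrable_one_add_pow_mul_norm _ N).const_mul C) (fun n => ae_of_all _ fun t => ?_)
      (ae_of_all _ fun t => ?_)
    · exact ((𝓕 plateau).continuous.mul
        (hφ.continuous.comp (by fun_prop))).aestronglyMeasurable
    · rw [norm_mul]
      have : |((n : ℝ) + 1)⁻¹ * t| ≤ |t| := by
        rw [abs_mul, abs_of_pos (by positivity)]
        exact mul_le_of_le_one_left (abs_nonneg t) (inv_le_one_of_one_le₀ (by linarith [n.cast_nonneg (α := ℝ)]))
      calc _ ≤ ‖𝓕 plateau t‖ * (C * (1 + |((n : ℝ) + 1)⁻¹ * t|) ^ N) := by gcongr; exact hC _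
        _ ≤ ‖𝓕 plateau t‖ * (C * (1 + |t|) ^ N) := by gcongr
        _ = _ := by ring
    · refine tendsto_const_nhds.mul ((hφ.continuous.tendsto 0).comp ?_)
      have : Tendsto (fun n : ℕ => ((n : ℝ) + 1)⁻¹) atTop (𝓝 0) := by
        simpa using tendsto_one_div_add_atTop_nhds_zero_nat (𝕜 := ℝ)
      simpa using this.mul_const t
  simp only [hzero] at hlim
  have h0 := tendsto_nhds_unique hlim tendsto_const_nhds
  -- The total mass is the value of `plateau` at 0, by Fourier inversion.
  have h1 : ∫ t, 𝓕 plateau t = 1 := by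
    have : 𝓕⁻ (𝓕 plateau) 0 = 1 := by
      rw [FourierTransform.fourierInv_fourier_eq]
      exact plateau_eq_one (by simp)
    rw [SchwartzMap.fourierInv_coe, Real.fourierInv_eq'] at this
    simpa using this
  rw [integral_mul_const, h1, one_mul] at h0
  exact h0

theorem tendsto_integral_norm_sub_translate (κ : 𝓢(ℝ, ℂ)) :
    Tendsto (fun y : ℝ => ∫ t, ‖κ t - κ (t - y)‖) (𝓝 0) (𝓝 0) := by
  obtain ⟨D, hD⟩ : ∃ D : ℝ, ∀ t, ‖κ t‖ ≤ D * (1 + t ^ 2)⁻¹ := by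
    refine ⟨SchwartzMap.seminorm ℝ 0 0 κ + SchwartzMap.seminorm ℝ 2 0 κ, fun t => ?_⟩
    rw [← div_eq_mul_inv, le_div_iff₀ (by positivity)]
    have h0 := SchwartzMap.norm_le_seminorm ℝ κ t
    have h2 := SchwartzMap.norm_pow_mul_le_seminorm ℝ κ 2 t
    rw [Real.norm_eq_abs, sq_abs] at h2
    linarith
  have hD0 : 0 ≤ D := by simpa using (norm_nonneg _).trans (hD 0)
  have h := tendsto_integral_filter_of_dominated_convergence (μ := volume) (l := 𝓝 (0 : ℝ))
    (F := fun y t => ‖κ t - κ (t - y)‖) (f := fun _ => (0 : ℝ))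
    (fun t : ℝ => 4 * D * (1 + t ^ 2)⁻¹) ?_ ?_ (integrable_inv_one_add_sq.const_mul _) ?_
  · simpa using h
  · have := κ.continuous
    exact Eventually.of_forall fun y => Continuous.aestronglyMeasurable (by fun_prop)
  · filter_upwards [Metric.ball_mem_nhds (0 : ℝ) one_pos] with y hy
    refine ae_of_all _ fun t => ?_
    have hy' : y ^ 2 ≤ 1 := by
      rw [sq_le_one_iff_abs_le_one]
      simpa using (Metric.mem_ball.1 hy).le
    -- For |y| ≤ 1 one has t² ≤ 2(t - y)² + 2, hence the factor 3.
    have h1 : (1 + (t - y) ^ 2)⁻¹ ≤ 3 * (1 + t ^ 2)⁻¹ := by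
      rw [← div_eq_mul_inv, le_div_iff₀ (by positivity), inv_mul_le_iff₀ (by positivity)]
      nlinarith [sq_nonneg (t - 2 * y)]
    rw [norm_norm]
    calc _ ≤ ‖κ t‖ + ‖κ (t - y)‖ := norm_sub_le _ _
      _ ≤ D * (1 + t ^ 2)⁻¹ + D * (3 * (1 + t ^ 2)⁻¹) :=
        add_le_add (hD t) ((hD _).trans (by gcongr))
      _ = _ := by ring
  · refine ae_of_all _ fun t => ?_
    have hc : Continuous fun y => ‖κ t - κ (t - y)‖ := by
      have := κ.continuous
      fun_prop
    simpa using hc.tendsto 0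

theorem integral_norm_sub_translate_le (κ : 𝓢(ℝ, ℂ)) (y : ℝ) :
    ∫ t, ‖κ t - κ (t - y)‖ ≤ 2 * ∫ t, ‖κ t‖ := by
  have hi : Integrable fun t => ‖κ (t - y)‖ := (κ.integrable.comp_sub_right y).norm
  calc _ ≤ ∫ t, (‖κ t‖ + ‖κ (t - y)‖) :=
        integral_mono (κ.integrable.sub (κ.integrable.comp_sub_right y)).norm
          (κ.integrable.norm.add hi) fun t => norm_sub_le _ _
    _ = _ := by
        rw [integral_add κ.integrable.norm hi,
          integral_sub_right_eq_self (μ := volume) (fun t => ‖κ t‖) y]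
        ring

/-- For κ = 𝓕 `plateau`, this integral controls the error made in replacing a function of frequency
within `c` of ξ₀ by a character under integration against `f`. Dominated convergence makes it small
for small `c`. -/
theorem tendsto_integral_mul_dilate {f : ℝ → ℂ} (hf : Integrable f) (κ : 𝓢(ℝ, ℂ)) :
    Tendsto (fun c : ℝ => ∫ x, ‖f x‖ * ∫ t, ‖κ t - κ (t - c * x)‖) (𝓝 0) (𝓝 0) := by
  have h := tendsto_integral_filter_of_dominated_convergence (μ := volume) (l := 𝓝 (0 : ℝ))
    (F := fun c x => ‖f x‖ * ∫ t, ‖κ t - κ (t - c * x)‖) (f := fun _ => (0 : ℝ))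
    (fun x => ‖f x‖ * (2 * ∫ t, ‖κ t‖)) ?_ ?_ (hf.norm.mul_const _) ?_
  · simpa using h
  · refine Eventually.of_forall fun c => hf.aestronglyMeasurable.norm.mul ?_
    have hm : Continuous fun p : ℝ × ℝ => ‖κ p.2 - κ (p.2 - c * p.1)‖ := by
      have := κ.continuous
      fun_prop
    exact (hm.stronglyMeasurable.integral_prod_right (ν := volume)).aestronglyMeasurable
  · refine Eventually.of_forall fun c => ae_of_all _ fun x => ?_
    rw [Real.norm_of_nonneg (by positivity)]
    gcongr
    exact integral_norm_sub_translate_le _ _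
  · refine ae_of_all _ fun x => ?_
    have hc : Tendsto (fun c : ℝ => c * x) (𝓝 0) (𝓝 0) := by
      simpa using (continuous_mul_const x).tendsto 0
    simpa using ((tendsto_integral_norm_sub_translate κ).comp hc).const_mul ‖f x‖

end Wiener

/-! ### A local Wiener argument for integrable annihilators. -/

section LocalWiener

open scoped FourierTransform ContDiff
open FourierTransform

/-- A function `ψ` which is reproduced by the kernel `𝓕 (rescale c ξ₀ q)` is close to a character
with frequency `ξ₀`. -/
theorem norm_character_mul_sub_translate_le {ψ : ℝ → ℂ} (hψ : Continuous ψ) {B : ℝ}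
    (hB : ∀ t, ‖ψ t‖ ≤ B) {c ξ₀ : ℝ} (hc : 0 < c) (q : 𝓢(ℝ, ℂ))
    (hrep : ∀ r, ψ r = ∫ s, 𝓕 (rescale c ξ₀ hc q) s * ψ (r + s)) (r x : ℝ) :
    ‖Complex.exp (2 * Real.pi * x * ξ₀ * Complex.I) * ψ r - ψ (r + x)‖
      ≤ (∫ t, ‖𝓕 q t - 𝓕 q (t - c * x)‖) * B := by
  set K : 𝓢(ℝ, ℂ) := 𝓕 (rescale c ξ₀ hc q) with hK
  have hint : ∀ r, Integrable fun s => K s * ψ (r + s) := fun r =>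
    K.integrable.mul_bdd (c := B) (hψ.comp (by fun_prop)).aestronglyMeasurable
      (ae_of_all _ fun t => hB _)
  have hint2 : Integrable fun s => K (s - x) * ψ (r + s) :=
    (K.integrable.comp_sub_right x).mul_bdd (c := B) (hψ.comp (by fun_prop)).aestronglyMeasurable
      (ae_of_all _ fun t => hB _)
  have h1 : ψ (r + x) = ∫ s, K (s - x) * ψ (r + s) := by
    rw [hrep (r + x), ← integral_sub_right_eq_self (μ := volume) _ x]
    refine integral_congr_ae (ae_of_all _ fun s => ?_)
    simp only
    congr 2
    ring
  set e := Complex.exp (2 * Real.pi * x * ξ₀ * Complex.I) with he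
  have h2 : e * ψ r - ψ (r + x) = ∫ s, (e * K s - K (s - x)) * ψ (r + s) := by
    rw [h1]
    nth_rewrite 1 [hrep r]
    rw [← integral_const_mul, ← integral_sub ((hint r).const_mul e) hint2]
    refine integral_congr_ae (ae_of_all _ fun s => ?_)
    simp only
    ring
  -- By `fourier_rescale` both terms carry the same unimodular phase e^{2πi(x - s)ξ₀}, so only the
  -- translation difference of 𝓕 q remains.
  have h3 : ∀ s, ‖e * K s - K (s - x)‖ = c * ‖𝓕 q (c * s) - 𝓕 q (c * s - c * x)‖ := fun s => by
    have : e * K s - K (s - x) = c * Complex.exp (2 * Real.pi * (x - s) * ξ₀ * Complex.I) *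
        (𝓕 q (c * s) - 𝓕 q (c * s - c * x)) := by
      rw [hK, fourier_rescale, fourier_rescale, he, mul_sub, mul_sub]
      congr 1
      · rw [show 2 * (Real.pi : ℂ) * (x - s) * ξ₀ * Complex.I = 2 * Real.pi * x * ξ₀ * Complex.I +
          -(2 * Real.pi * s * ξ₀ * Complex.I) by ring, Complex.exp_add]
        ring
      · congr 3
        push_cast
        ring
    rw [this, norm_mul, norm_mul, Complex.norm_real, Real.norm_of_nonneg hc.le]
    have : ‖Complex.exp (2 * Real.pi * (x - s) * ξ₀ * Complex.I)‖ = 1 := by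
      have := Complex.norm_exp_ofReal_mul_I (2 * Real.pi * (x - s) * ξ₀)
      push_cast at this
      exact this
    rw [this, mul_one]
  have hintn : Integrable fun s => ‖e * K s - K (s - x)‖ :=
    ((K.integrable.const_mul e).sub (K.integrable.comp_sub_right x)).norm
  have h4 : ∫ s, ‖e * K s - K (s - x)‖ = ∫ t, ‖𝓕 q t - 𝓕 q (t - c * x)‖ := by
    simp only [h3]
    rw [integral_const_mul,
      Measure.integral_comp_mul_left (fun t => ‖𝓕 q t - 𝓕 q (t - c * x)‖) c,
      abs_of_pos (inv_pos.2 hc), smul_eq_mul, mul_inv_cancel_left₀ hc.ne']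
  rw [h2, ← h4, ← integral_mul_const]
  refine norm_integral_le_of_norm_le (hintn.mul_const B) (ae_of_all _ fun s => ?_)
  rw [norm_mul]
  gcongr
  exact hB _

/-- For `k` supported within `c` of ξ₀, the function ψ pairing 𝓕 k with the translates of φ nearly
satisfies ψ(r + x) = e^{2πi x ξ₀} ψ(r). Since `f` also annihilates the translates of ψ, integrating
this against `f` bounds |𝓕⁻ f(ξ₀)| · |ψ(r)| by a small multiple of sup |ψ|, which forces ψ = 0. -/
theorem FourierVanishes.of_integrable {φ : ℝ → ℂ} (hφ : Continuous φ) {B : ℝ}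
    (hB : ∀ t, ‖φ t‖ ≤ B) {f : ℝ → ℂ} (hf : Integrable f)
    (hf0 : ∀ r, ∫ t, f t * φ (t + r) = 0) {ξ₀ : ℝ} (hξ₀ : 𝓕⁻ f ξ₀ ≠ 0) :
    ∃ U ∈ 𝓝 ξ₀, FourierVanishes φ U := by
  have hφp : IsPolyGrowth φ := ⟨hφ, B, 0, by simpa using hB⟩
  have hB0 : 0 ≤ B := (norm_nonneg _).trans (hB 0)
  -- The radius `c` is fixed before `k`; the bound |𝓕⁻ f(ξ₀)| / 2 is what yields the contraction
  -- factor 1/2 in `hstep`.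
  obtain ⟨c, hc, hlt⟩ : ∃ c > 0,
      ∫ x, ‖f x‖ * ∫ t, ‖𝓕 plateau t - 𝓕 plateau (t - c * x)‖ < ‖𝓕⁻ f ξ₀‖ / 2 := by
    have h := ((tendsto_integral_mul_dilate hf (𝓕 plateau)).mono_left
      (nhdsWithin_le_nhds (s := Set.Ioi 0))).eventually
      (gt_mem_nhds (half_pos (norm_pos_iff.2 hξ₀)))
    obtain ⟨c, h1, h2⟩ := (h.and self_mem_nhdsWithin).exists
    exact ⟨c, h2, h1⟩
  refine ⟨Metric.closedBall ξ₀ c, Metric.closedBall_mem_nhds _ hc, fun k hk hs => ?_⟩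
  set ψ : ℝ → ℂ := fun r => ∫ t, 𝓕 k t * φ (t + r) with hψdef
  have hψ : Continuous ψ := by
    refine continuous_of_dominated (bound := fun t => ‖𝓕 k t‖ * B) (fun r => ?_)
      (fun r => ae_of_all _ fun t => ?_) ((𝓕 k).integrable.norm.mul_const _)
      (ae_of_all _ fun t => ?_)
    · exact ((𝓕 k).continuous.mul (hφ.comp (by fun_prop))).aestronglyMeasurable
    · rw [norm_mul]
      gcongr
      exact hB _
    · exact continuous_const.mul (hφ.comp (by fun_prop))
  -- The rescaled plateau is 1 on the support of `k`; transformed, this is the reproducing formula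
  -- `hrep`.
  have hkc : schwartzMul (rescale c ξ₀ hc plateau) k = k := by
    ext ξ
    rw [schwartzMul_apply]
    by_cases hξ : k ξ = 0
    · simp [hξ]
    · rw [rescale_plateau_eq_one hc, one_mul]
      simpa [Real.dist_eq] using hs (subset_tsupport _ hξ)
  have hrep : ∀ r, ψ r = ∫ s, 𝓕 (rescale c ξ₀ hc plateau) s * ψ (r + s) := fun r => by
    have h := integral_fourier_schwartzMul (hφp.translate r) (rescale c ξ₀ hc plateau) k
    rw [hkc] at h
    simp only [hψdef, h]
    refine integral_congr_ae (ae_of_all _ fun s => ?_)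
    simp only [add_assoc, add_comm r]
  have hψf : ∀ r, ∫ x, f x * ψ (r + x) = 0 := fun r => by
    have hint : Integrable (fun p : ℝ × ℝ => f p.1 * 𝓕 k p.2 * φ (p.2 + (r + p.1)))
        (volume.prod volume) :=
      (hf.mul_prod (𝓕 k).integrable).mul_bdd (c := B)
        (hφ.comp (by fun_prop)).aestronglyMeasurable (ae_of_all _ fun p => hB _)
    calc ∫ x, f x * ψ (r + x) = ∫ x, ∫ t, f x * 𝓕 k t * φ (t + (r + x)) := by
          simp only [hψdef, ← integral_const_mul, mul_assoc]
      _ = ∫ t, ∫ x, f x * 𝓕 k t * φ (t + (r + x)) :=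
          integral_integral_swap (f := fun x t => f x * 𝓕 k t * φ (t + (r + x))) hint
      _ = ∫ t, 𝓕 k t * ∫ x, f x * φ (x + (t + r)) := by
          refine integral_congr_ae (ae_of_all _ fun t => ?_)
          simp only
          rw [← integral_const_mul]
          refine integral_congr_ae (ae_of_all _ fun x => ?_)
          simp only [show t + (r + x) = x + (t + r) by ring]
          ring
      _ = 0 := by simp [hf0]
  set A := ∫ x, ‖f x‖ * ∫ t, ‖𝓕 plateau t - 𝓕 plateau (t - c * x)‖ with hA
  have hstep : ∀ D, (∀ t, ‖ψ t‖ ≤ D) → ∀ r, ‖ψ r‖ ≤ D / 2 := by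
    intro D hD r
    have hD0 : 0 ≤ D := (norm_nonneg _).trans (hD 0)
    have hfe : Integrable fun x : ℝ => f x * Complex.exp (2 * Real.pi * x * ξ₀ * Complex.I) := by
      refine hf.mul_bdd (c := 1) (Continuous.aestronglyMeasurable (by fun_prop))
        (ae_of_all _ fun x => ?_)
      have := Complex.norm_exp_ofReal_mul_I (2 * Real.pi * x * ξ₀)
      push_cast at this
      exact this.le
    have hfψ : Integrable fun x => f x * ψ (r + x) :=
      hf.mul_bdd (c := D) (hψ.comp (by fun_prop)).aestronglyMeasurable (ae_of_all _ fun x => hD _)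
    have h1 : 𝓕⁻ f ξ₀ * ψ r
        = ∫ x, f x * (Complex.exp (2 * Real.pi * x * ξ₀ * Complex.I) * ψ r - ψ (r + x)) := by
      have : 𝓕⁻ f ξ₀ = ∫ x, f x * Complex.exp (2 * Real.pi * x * ξ₀ * Complex.I) := by
        rw [Real.fourierInv_eq']
        refine integral_congr_ae (ae_of_all _ fun x => ?_)
        simp only [smul_eq_mul, RCLike.inner_apply, conj_trivial]
        rw [mul_comm]
        congr 2
        push_cast
        ring
      rw [this, ← integral_mul_const, ← sub_zero (∫ _, _), ← hψf r,
        ← integral_sub (hfe.mul_const _) hfψ]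
      refine integral_congr_ae (ae_of_all _ fun x => ?_)
      simp only
      ring
    have hω : Integrable fun x => ‖f x‖ * ∫ t, ‖𝓕 plateau t - 𝓕 plateau (t - c * x)‖ := by
      refine hf.norm.mul_bdd (c := 2 * ∫ t, ‖𝓕 plateau t‖) ?_ (ae_of_all _ fun x => ?_)
      · have hm : Continuous fun p : ℝ × ℝ => ‖𝓕 plateau p.2 - 𝓕 plateau (p.2 - c * p.1)‖ := by
          have := (𝓕 plateau).continuous
          fun_prop
        exact (hm.stronglyMeasurable.integral_prod_right (ν := volume)).aestronglyMeasurable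
      · rw [Real.norm_of_nonneg (by positivity)]
        exact integral_norm_sub_translate_le _ _
    have h2 : ‖𝓕⁻ f ξ₀‖ * ‖ψ r‖ ≤ A * D := by
      rw [← norm_mul, h1, hA, ← integral_mul_const]
      refine norm_integral_le_of_norm_le (hω.mul_const D) (ae_of_all _ fun x => ?_)
      rw [norm_mul]
      exact (mul_le_mul_of_nonneg_left (norm_character_mul_sub_translate_le hψ hD hc plateau hrep
        r x) (norm_nonneg _)).trans_eq (mul_assoc _ _ _).symm
    have hpos := norm_pos_iff.2 hξ₀
    have h3 : ‖𝓕⁻ f ξ₀‖ * ‖ψ r‖ ≤ ‖𝓕⁻ f ξ₀‖ * (D / 2) := h2.trans (by nlinarith)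
    exact le_of_mul_le_mul_left h3 hpos
  have hψB : ∀ t, ‖ψ t‖ ≤ (∫ t, ‖𝓕 k t‖) * B := fun r => by
    rw [← integral_mul_const]
    refine norm_integral_le_of_norm_le ((𝓕 k).integrable.norm.mul_const B) (ae_of_all _ fun t => ?_)
    rw [norm_mul]
    gcongr
    exact hB _
  have hbdd : BddAbove (Set.range fun t => ‖ψ t‖) := ⟨_, by rintro _ ⟨t, rfl⟩; exact hψB t⟩
  -- The supremum is finite and at most half of itself, hence 0; the pairing in question is ψ(0).
  have hsup : ⨆ t, ‖ψ t‖ ≤ (⨆ t, ‖ψ t‖) / 2 := ciSup_le (hstep _ (le_ciSup hbdd))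
  have h0 : ‖ψ 0‖ ≤ 0 := (le_ciSup hbdd 0).trans (by linarith)
  simpa [hψdef] using norm_le_zero_iff.1 h0

end LocalWiener

/-! ### Spectrum on the diagonal. -/

section Product

open scoped FourierTransform ContDiff
open FourierTransform

theorem tsupport_convolution_subset {k h : 𝓢(ℝ, ℂ)} (hk : HasCompactSupport k)
    (hh : HasCompactSupport h) :
    tsupport (SchwartzMap.convolution (ContinuousLinearMap.mul ℂ ℂ) k h)
      ⊆ tsupport k + tsupport h := by
  refine closure_minimal (fun ξ hξ => ?_) (IsCompact.add hk hh).isClosed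
  rw [Function.mem_support, SchwartzMap.convolution_apply] at hξ
  have h1 := support_convolution_subset (ContinuousLinearMap.mul ℂ ℂ) (μ := volume) hξ
  exact Set.add_subset_add (subset_tsupport _) (subset_tsupport _) h1

/-- For fixed `r`, the function t ↦ 𝓕 h(r - t) is the transform of a modulated reflection of `h`.
The product with 𝓕 k is thus the transform of a convolution supported in tsupport k - tsupport h. -/
theorem FourierVanishes.mul_fourier {φ : ℝ → ℂ} {O : Set ℝ} (hφ : FourierVanishes φ O)
    {k h : 𝓢(ℝ, ℂ)} (hk : HasCompactSupport k) (hh : HasCompactSupport h)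
    (hO : tsupport k - tsupport h ⊆ O) (r : ℝ) :
    ∫ t, 𝓕 k t * 𝓕 h (r - t) * φ t = 0 := by
  have hrc : HasCompactSupport (reflect h) := hh.comp_homeomorph (Homeomorph.neg ℝ)
  set m := modulate r (reflect h) hrc with hm
  have hmc : HasCompactSupport m := hasCompactSupport_modulate _ _ _
  have hms : tsupport m = -tsupport h := by
    rw [tsupport, hm, support_modulate]
    exact tsupport_comp_eq_preimage h (Homeomorph.neg ℝ)
  have hsub := (tsupport_convolution_subset hk hmc)
  rw [hms] at hsub
  have hcomp := IsCompact.add hk (IsCompact.neg hh)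
  have key := hφ (SchwartzMap.convolution (ContinuousLinearMap.mul ℂ ℂ) k m)
    (hcomp.of_isClosed_subset (isClosed_tsupport _) hsub)
    (hsub.trans (by rwa [← sub_eq_add_neg]))
  rw [← key]
  refine integral_congr_ae (ae_of_all _ fun t => ?_)
  simp only
  rw [SchwartzMap.fourier_convolution, SchwartzMap.pairing_apply_apply, hm, fourier_modulate,
    fourier_reflect, neg_sub]
  rfl

/-- The spectrum of the restriction to the diagonal of a function of two variables. -/
theorem FourierVanishes.diagonal {Φ : ℝ × ℝ → ℂ} (hΦ : Continuous Φ) {C : ℝ} {N : ℕ}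
    (hC : ∀ p, ‖Φ p‖ ≤ C * (1 + |p.1|) ^ N) {E F : Set ℝ}
    (hE : ∀ t, FourierVanishes (fun s => Φ (s, t)) (closure E)ᶜ)
    (hF : ∀ s, FourierVanishes (fun t => Φ (s, t)) (closure F)ᶜ) :
    FourierVanishes (fun t => Φ (t, t)) (closure (E + F))ᶜ := by
  intro k hk hs
  have hC0 : 0 ≤ C := by simpa using (norm_nonneg _).trans (hC 0)
  -- The offset `r` from the diagonal is made a variable of its own; the claim is w(0) = 0, and it
  -- follows once the transform of `w` vanishes locally everywhere.
  set w : ℝ → ℂ := fun r => ∫ t, 𝓕 k t * Φ (t, t + r) with hw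
  have hbi := (integrable_one_add_pow_mul_norm (𝓕 k) N).const_mul C
  have hb : ∀ t r, ‖𝓕 k t * Φ (t, t + r)‖ ≤ C * ((1 + |t|) ^ N * ‖𝓕 k t‖) := fun t r => by
    rw [norm_mul]
    calc _ ≤ ‖𝓕 k t‖ * (C * (1 + |t|) ^ N) := by gcongr; exact hC (t, t + r)
      _ = _ := by ring
  have hwp : IsPolyGrowth w := by
    refine ⟨?_, ∫ t, C * ((1 + |t|) ^ N * ‖𝓕 k t‖), 0, fun r => ?_⟩
    · refine continuous_of_dominated (fun r => ?_) (fun r => ae_of_all _ fun t => hb t r) hbi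
        (ae_of_all _ fun t => continuous_const.mul (hΦ.comp (by fun_prop)))
      exact ((𝓕 k).continuous.mul (hΦ.comp (by fun_prop))).aestronglyMeasurable
    · simpa using norm_integral_le_of_norm_le hbi (ae_of_all _ fun t => hb t r)
  have hint : ∀ h : 𝓢(ℝ, ℂ), Integrable
      (fun p : ℝ × ℝ => 𝓕 k p.1 * 𝓕 h (p.2 - p.1) * Φ p) (volume.prod volume) := fun h => by
    refine integrable_mul_mul_sub (𝓕 k) (𝓕 h) hΦ (C := C) (N := N) fun p => (hC p).trans ?_
    gcongr
    exact le_mul_of_one_le_right (by positivity) (one_le_pow₀ (by simp))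
  have hint' : ∀ h : 𝓢(ℝ, ℂ), Integrable
      (fun p : ℝ × ℝ => 𝓕 k p.1 * 𝓕 h p.2 * Φ (p.1, p.1 + p.2)) (volume.prod volume) := fun h => by
    have h1 := (integrable_one_add_pow_mul_norm (𝓕 k) N).mul_prod ((𝓕 h).integrable (μ := volume)).norm
    refine (h1.const_mul C).mono' ?_ (ae_of_all _ fun p => ?_)
    · have := (𝓕 k).continuous
      have := (𝓕 h).continuous
      exact Continuous.aestronglyMeasurable (by fun_prop)
    · rw [mul_right_comm, norm_mul]
      calc _ ≤ C * ((1 + |p.1|) ^ N * ‖𝓕 k p.1‖) * ‖𝓕 h p.2‖ := by gcongr; exact hb _ _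
        _ = _ := by ring
  have hswap : ∀ h : 𝓢(ℝ, ℂ), ∫ r, 𝓕 h r * w r = ∫ t, 𝓕 k t * ∫ r, 𝓕 h r * Φ (t, t + r) := by
    intro h
    have e := integral_integral_swap (f := fun t r => 𝓕 k t * 𝓕 h r * Φ (t, t + r)) (hint' h)
    calc _ = ∫ r, ∫ t, 𝓕 k t * 𝓕 h r * Φ (t, t + r) := by
          refine integral_congr_ae (ae_of_all _ fun r => ?_)
          simp only [hw]
          rw [← integral_const_mul]
          refine integral_congr_ae (ae_of_all _ fun t => ?_)
          simp only
          ring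
      _ = _ := e.symm
      _ = _ := by simp only [mul_assoc, integral_const_mul]
  have hvan : FourierVanishes w Set.univ := by
    refine FourierVanishes.of_local hwp fun b _ => ?_
    -- If `b` lies in the closure of `F`, the support of `k` misses closure E + b with a positive
    -- gap δ. For `h` supported within δ of `b`, the set tsupport k - tsupport h then avoids the
    -- closure of `E`, and integrating first along the first variable of Φ gives 0. If not,
    -- integrating first along the second variable gives 0.
    by_cases hb : b ∈ closure F
    · have hdis : Disjoint (tsupport k) (closure E + {b}) := by
        rw [Set.disjoint_left]
        rintro x hx hx'
        obtain ⟨e, he, b', rfl, rfl⟩ := hx'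
        exact hs hx (map_mem_closure₂ continuous_add he hb fun a ha c hc => Set.add_mem_add ha hc)
      have hcl : IsClosed (closure E + {b}) := by
        rw [Set.add_singleton]
        exact (Homeomorph.addRight b).isClosedMap _ isClosed_closure
      obtain ⟨δ, hδ, hδd⟩ := hdis.exists_thickenings hk hcl
      refine ⟨Metric.ball b δ, Metric.ball_mem_nhds b hδ, fun h hh hhs => ?_⟩
      have hsub : tsupport k - tsupport h ⊆ (closure E)ᶜ := by
        rintro _ ⟨x, hx, y, hy, rfl⟩ hxy
        refine Set.disjoint_left.1 hδd (Metric.self_subset_thickening hδ _ hx) ?_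
        rw [Metric.mem_thickening_iff]
        refine ⟨x - y + b, Set.add_mem_add hxy rfl, ?_⟩
        have := Metric.mem_ball.1 (hhs hy)
        rw [Real.dist_eq] at this ⊢
        convert this using 2
        ring
      rw [hswap]
      have e := integral_integral_swap (f := fun t r => 𝓕 k t * 𝓕 h (r - t) * Φ (t, r)) (hint h)
      calc _ = ∫ t, ∫ r, 𝓕 k t * 𝓕 h (r - t) * Φ (t, r) := by
            refine integral_congr_ae (ae_of_all _ fun t => ?_)
            simp only [mul_assoc, integral_const_mul]
            rw [← integral_add_right_eq_self (μ := volume) (fun r => 𝓕 h (r - t) * Φ (t, r)) t]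
            simp [add_comm]
        _ = _ := e
        _ = 0 := by
            simp [(hE _).mul_fourier hk hh hsub]
    · refine ⟨(closure F)ᶜ, isClosed_closure.isOpen_compl.mem_nhds hb, fun h hh hhs => ?_⟩
      rw [hswap]
      have : ∀ t, ∫ r, 𝓕 h r * Φ (t, t + r) = 0 := fun t => by
        simpa only [add_comm t] using (hF t).translate t h hh hhs
      simp [this]
  simpa [hw] using hvan.apply_zero_eq_zero hwp

end Product

/-! ### Directional derivatives in locally convex spaces. -/

section DirDeriv

variable {V W : Type*} [AddCommGroup V] [Module ℝ V] [AddCommGroup W] [Module ℝ W]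
  [TopologicalSpace W]

theorem HasDirDeriv.unique [T2Space W] {f : V → W} {x h : V} {w w' : W}
    (h₁ : HasDirDeriv f x h w) (h₂ : HasDirDeriv f x h w') : w = w' :=
  tendsto_nhds_unique h₁ h₂

theorem HasDirDeriv.add [IsTopologicalAddGroup W] {f g : V → W} {x h : V} {w w' : W}
    (hf : HasDirDeriv f x h w) (hg : HasDirDeriv g x h w') :
    HasDirDeriv (fun z => f z + g z) x h (w + w') := by
  refine (Tendsto.add hf hg).congr fun s => ?_
  rw [← smul_add]
  congr 1
  exact sub_add_sub_comm _ _ _ _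

theorem HasDirDeriv.clm_apply {W' : Type*} [AddCommGroup W'] [Module ℝ W'] [TopologicalSpace W']
    {f : V → W} {x h : V} {w : W} (hf : HasDirDeriv f x h w) (L : W →L[ℝ] W') :
    HasDirDeriv (fun z => L (f z)) x h (L w) := by
  refine ((L.continuous.tendsto w).comp hf).congr fun s => ?_
  simp

theorem HasDirDeriv.smul_const [ContinuousSMul ℝ W] [IsTopologicalAddGroup W] {f : V → W} {x h : V}
    {w : W} (hf : HasDirDeriv f x h w) (a : ℝ) : HasDirDeriv (fun z => a • f z) x h (a • w) :=
  hf.clm_apply (a • ContinuousLinearMap.id ℝ W)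

theorem HasDirDeriv.congr_of_eqOn [TopologicalSpace V] [IsTopologicalAddGroup V]
    [ContinuousSMul ℝ V] {f g : V → W} {x h : V} {w : W} {U : Set V}
    (hf : HasDirDeriv f x h w) (hU : IsOpen U) (hx : x ∈ U) (hfg : Set.EqOn f g U) :
    HasDirDeriv g x h w := by
  have hc : Tendsto (fun s : ℝ => x + s • h) (𝓝[≠] 0) (𝓝 x) := by
    have : Continuous fun s : ℝ => x + s • h := by fun_prop
    simpa using (this.tendsto 0).mono_left nhdsWithin_le_nhds
  refine Tendsto.congr' ?_ hf
  filter_upwards [hc (hU.mem_nhds hx)] with s hs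
  rw [hfg hs, hfg hx]

theorem HasDirDeriv.smul_dir [ContinuousSMul ℝ W] [IsTopologicalAddGroup W] {f : V → W} {x h : V}
    {w : W} (hf : HasDirDeriv f x h w) (a : ℝ) : HasDirDeriv f x (a • h) (a • w) := by
  rcases eq_or_ne a 0 with rfl | ha
  · simp [HasDirDeriv, tendsto_const_nhds]
  · have h1 : Tendsto (fun s : ℝ => s * a) (𝓝[≠] 0) (𝓝[≠] 0) := by
      refine tendsto_nhdsWithin_iff.2 ⟨?_, ?_⟩
      · simpa using ((continuous_mul_const a).tendsto 0).mono_left nhdsWithin_le_nhds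
      · filter_upwards [self_mem_nhdsWithin] with s hs
        exact mul_ne_zero hs ha
    refine ((Tendsto.comp hf h1).const_smul a).congr fun s => ?_
    simp only [Function.comp_apply, smul_smul, mul_inv]
    congr 1
    field_simp

theorem dirDeriv_smul [T2Space W] [ContinuousSMul ℝ W] [IsTopologicalAddGroup W] {f : V → W} {df : V × V → W} {U : Set V}
    (hd : ∀ x ∈ U, ∀ h, HasDirDeriv f x h (df (x, h)))
    {x : V} (hx : x ∈ U) (a : ℝ) (h : V) : df (x, a • h) = a • df (x, h) :=
  (hd x hx _).unique ((hd x hx h).smul_dir a)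

/-- A mean value theorem: if the quotient were outside the convex set, Hahn–Banach would separate it
by a functional, contradicting the scalar mean value theorem along the segment. -/
theorem slope_mem_of_convex [IsTopologicalAddGroup W] [ContinuousSMul ℝ W] {f : V → W}
    {x h : V} {s : ℝ} (hs : s ≠ 0) {d : ℝ → W} {C : Set W} (hCo : IsOpen C) (hC : Convex ℝ C)
    (hd : ∀ τ ∈ Set.Icc (0 : ℝ) 1, HasDirDeriv f (x + (τ * s) • h) h (d τ) ∧ d τ ∈ C) :
    s⁻¹ • (f (x + s • h) - f x) ∈ C := by
  by_contra hn
  obtain ⟨l, hl⟩ := geometric_hahn_banach_open_point hC hCo hn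
  have hder : ∀ τ ∈ Set.Icc (0 : ℝ) 1,
      HasDerivAt (fun τ : ℝ => l (f (x + (τ * s) • h))) (l (d τ) * s) τ := by
    intro τ hτ
    have h1 : HasDerivAt (fun σ : ℝ => l (f (x + σ • h))) (l (d τ)) (τ * s) := by
      rw [hasDerivAt_iff_tendsto_slope_zero]
      refine ((l.continuous.tendsto _).comp (hd τ hτ).1).congr fun t => ?_
      simp [add_smul, add_assoc]
    exact h1.comp τ (by simpa using (hasDerivAt_id τ).mul_const s)
  obtain ⟨c, hc, hceq⟩ := exists_hasDerivAt_eq_slope _ _ zero_lt_one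
    (fun τ hτ => (hder τ hτ).continuousAt.continuousWithinAt)
    (fun τ hτ => hder τ (Set.Ioo_subset_Icc_self hτ))
  have hlt := hl _ (hd c (Set.Ioo_subset_Icc_self hc)).2
  simp only [one_mul, zero_mul, zero_smul, add_zero, sub_zero, div_one] at hceq
  rw [map_smul, map_sub, ← hceq, smul_eq_mul, mul_comm (l _), inv_mul_cancel_left₀ hs] at hlt
  exact lt_irrefl _ hlt

variable [TopologicalSpace V] [IsTopologicalAddGroup V] [ContinuousSMul ℝ V]
  [IsTopologicalAddGroup W] [ContinuousSMul ℝ W] [LocallyConvexSpace ℝ W]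

/-- Continuous directional derivatives are locally uniform limits of difference quotients. -/
theorem tendsto_slope {f : V → W} {df : V × V → W} {U B : Set V} (hU : IsOpen U)
    (hd : ∀ x ∈ U, ∀ h ∈ B, HasDirDeriv f x h (df (x, h))) (hc : ContinuousOn df (U ×ˢ B))
    {ι : Type*} {l : Filter ι} {x h : ι → V} {s : ι → ℝ} {x₀ h₀ : V} (hx₀ : x₀ ∈ U) (hh₀ : h₀ ∈ B)
    (hx : Tendsto x l (𝓝 x₀)) (hh : Tendsto h l (𝓝 h₀)) (hB : ∀ᶠ i in l, h i ∈ B)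
    (hs : Tendsto s l (𝓝[≠] 0)) :
    Tendsto (fun i => (s i)⁻¹ • (f (x i + s i • h i) - f (x i))) l (𝓝 (df (x₀, h₀))) := by
  obtain ⟨hs0, hsne⟩ := tendsto_nhdsWithin_iff.1 hs
  -- The product with the principal filter of [0, 1] expresses convergence uniform in the position τ
  -- on the segment, as the mean value lemma requires.
  have hτ : Tendsto (fun p : ι × ℝ => p.2 * s p.1) (l ×ˢ 𝓟 (Set.Icc 0 1)) (𝓝 0) := by
    refine squeeze_zero_norm' (a := fun p => |s p.1|) ?_ ?_
    · filter_upwards [prod_mem_prod univ_mem (mem_principal_self _)] with p hp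
      rw [norm_mul, Real.norm_eq_abs, Real.norm_eq_abs, abs_of_nonneg hp.2.1]
      exact mul_le_of_le_one_left (abs_nonneg _) hp.2.2
    · simpa using (hs0.comp tendsto_fst).abs
  have hpt : Tendsto (fun p : ι × ℝ => x p.1 + (p.2 * s p.1) • h p.1) (l ×ˢ 𝓟 (Set.Icc 0 1))
      (𝓝 x₀) := by
    simpa using (hx.comp tendsto_fst).add (hτ.smul (hh.comp tendsto_fst))
  have hmem : ∀ᶠ p : ι × ℝ in l ×ˢ 𝓟 (Set.Icc 0 1),
      (x p.1 + (p.2 * s p.1) • h p.1, h p.1) ∈ U ×ˢ B := by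
    filter_upwards [hpt (hU.mem_nhds hx₀), tendsto_fst.eventually hB] with p h1 h2
    exact ⟨h1, h2⟩
  have hlim : Tendsto (fun p : ι × ℝ => df (x p.1 + (p.2 * s p.1) • h p.1, h p.1))
      (l ×ˢ 𝓟 (Set.Icc 0 1)) (𝓝 (df (x₀, h₀))) :=
    Tendsto.comp (hc (x₀, h₀) ⟨hx₀, hh₀⟩)
      (tendsto_nhdsWithin_iff.2 ⟨hpt.prodMk_nhds (hh.comp tendsto_fst), hmem⟩)
  rw [((LocallyConvexSpace.convex_basis (𝕜 := ℝ) (df (x₀, h₀)))).tendsto_right_iff]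
  rintro C ⟨hCn, hCc⟩
  have hCi := hlim (interior_mem_nhds.2 hCn)
  have hev := hmem.and hCi
  rw [eventually_prod_principal_iff] at hev
  filter_upwards [hev, hsne] with i hi hsi
  refine interior_subset (slope_mem_of_convex hsi isOpen_interior hCc.interior
    (d := fun τ => df (x i + (τ * s i) • h i, h i)) fun τ hτ => ?_)
  obtain ⟨h1, h2⟩ := hi τ hτ
  exact ⟨hd _ h1.1 _ h1.2, h2⟩

/-- Differentiation along a curve. -/
theorem tendsto_slope_curve {f : V → W} {df : V × V → W} {U : Set V} (hU : IsOpen U)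
    (hd : ∀ x ∈ U, ∀ h, HasDirDeriv f x h (df (x, h))) (hc : ContinuousOn df (U ×ˢ Set.univ))
    {c : ℝ → V} {x h : V} (hx : x ∈ U)
    (hch : Tendsto (fun s : ℝ => s⁻¹ • (c s - x)) (𝓝[≠] 0) (𝓝 h)) :
    Tendsto (fun s : ℝ => s⁻¹ • (f (c s) - f x)) (𝓝[≠] 0) (𝓝 (df (x, h))) := by
  refine (tendsto_slope hU (B := Set.univ) (fun x hx h _ => hd x hx h) hc hx (Set.mem_univ h)
    tendsto_const_nhds hch (Eventually.of_forall fun _ => Set.mem_univ _) tendsto_id).congr' ?_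
  filter_upwards [self_mem_nhdsWithin] with s hs
  simp [smul_smul, mul_inv_cancel₀ (show s ≠ 0 from hs)]

/-- The increment is split at x + s b. The step along `a` starts at a moving base point, so its
derivative must exist and be continuous near `x`; along `b` the derivative at `x` alone suffices. -/
theorem HasDirDeriv.add_dir {f : V → W} {df : V → W} {U : Set V} (hU : IsOpen U) {a : V}
    (hd : ∀ x ∈ U, HasDirDeriv f x a (df x)) (hc : ContinuousOn df U) {x b : V} (hx : x ∈ U)
    {w : W} (hb : HasDirDeriv f x b w) : HasDirDeriv f x (a + b) (df x + w) := by
  have h1 : Tendsto (fun s : ℝ => x + s • b) (𝓝[≠] 0) (𝓝 x) := by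
    have : Continuous fun s : ℝ => x + s • b := by fun_prop
    simpa using (this.tendsto 0).mono_left nhdsWithin_le_nhds
  have h2 := tendsto_slope (f := f) (df := fun p => df p.1) hU (B := {a})
    (fun x hx h hh => by rw [Set.mem_singleton_iff.1 hh]; exact hd x hx)
    (hc.comp continuousOn_fst fun p hp => hp.1) hx (Set.mem_singleton a) h1
    (tendsto_const_nhds (x := a)) (Eventually.of_forall fun _ => Set.mem_singleton a) tendsto_id
  refine (h2.add hb).congr fun s => ?_
  simp only [id]
  rw [← smul_add, sub_add_sub_cancel, smul_add, add_assoc, add_comm (s • b)]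

theorem HasDirDeriv.sum_dir {ι : Type*} (I : Finset ι) {f : V → W} {df : ι → V → W} {U : Set V}
    (hU : IsOpen U) {a : ι → V} (hd : ∀ i ∈ I, ∀ x ∈ U, HasDirDeriv f x (a i) (df i x))
    (hc : ∀ i ∈ I, ContinuousOn (df i) U) {x : V} (hx : x ∈ U) :
    HasDirDeriv f x (∑ i ∈ I, a i) (∑ i ∈ I, df i x) := by
  classical
  induction I using Finset.induction_on with
  | empty => simp [HasDirDeriv, tendsto_const_nhds]
  | insert i I hi ih =>
    rw [Finset.sum_insert hi, Finset.sum_insert hi]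
    exact HasDirDeriv.add_dir hU (hd i (Finset.mem_insert_self _ _))
      (hc i (Finset.mem_insert_self _ _)) hx
      (ih (fun j hj => hd j (Finset.mem_insert_of_mem hj))
        fun j hj => hc j (Finset.mem_insert_of_mem hj))

theorem dirDeriv_add [T2Space W] {f : V → W} {df : V × V → W} {U : Set V} (hU : IsOpen U)
    (hd : ∀ x ∈ U, ∀ h, HasDirDeriv f x h (df (x, h))) (hc : ContinuousOn df (U ×ˢ Set.univ))
    {x : V} (hx : x ∈ U) (h k : V) : df (x, h + k) = df (x, h) + df (x, k) :=
  (hd x hx _).unique (HasDirDeriv.add_dir (df := fun z => df (z, h)) hU (fun z hz => hd z hz h)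
    (hc.comp (by fun_prop) fun z hz => ⟨hz, Set.mem_univ _⟩) hx (hd x hx k))

end DirDeriv

-- Finite order Michal–Bastiani differentiability and the chain rule.

universe u w

section Finite

variable {W : Type w} [AddCommGroup W] [Module ℝ W] [TopologicalSpace W]

/-- `f` is `n` times continuously differentiable on `U` in the sense of Michal and Bastiani:
the directional derivative `U × V → W` exists and is `n - 1` times continuously differentiable. -/
def IsBastianiC : (n : ℕ) → {V : Type u} → [AddCommGroup V] → [Module ℝ V] →
    [TopologicalSpace V] → (V → W) → Set V → Prop
  | 0, _, _, _, _, f, U => ContinuousOn f U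
  | n + 1, V, _, _, _, f, U => ContinuousOn f U ∧ ∃ df : V × V → W,
      (∀ x ∈ U, ∀ h, HasDirDeriv f x h (df (x, h))) ∧ IsBastianiC n df (U ×ˢ Set.univ)

variable {n : ℕ} {V : Type u} [AddCommGroup V] [Module ℝ V] [TopologicalSpace V]

theorem IsBastianiC.continuousOn {f : V → W} {U : Set V} (hf : IsBastianiC n f U) :
    ContinuousOn f U := by
  cases n with
  | zero => exact hf
  | succ n => exact hf.1

theorem IsBastianiC.mono {f : V → W} {U U' : Set V} (hf : IsBastianiC n f U) (hU : U' ⊆ U) :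
    IsBastianiC n f U' := by
  induction n generalizing V with
  | zero => exact ContinuousOn.mono hf hU
  | succ n ih =>
    obtain ⟨hc, df, hd, hn⟩ := hf
    exact ⟨hc.mono hU, df, fun x hx => hd x (hU hx), ih hn (Set.prod_mono_left hU)⟩

theorem IsBastianiC.of_succ {f : V → W} {U : Set V} (hf : IsBastianiC (n + 1) f U) :
    IsBastianiC n f U := by
  induction n generalizing V with
  | zero => exact hf.continuousOn
  | succ n ih =>
    obtain ⟨hc, df, hd, hn⟩ := hf
    exact ⟨hc, df, hd, ih hn⟩

theorem IsBastianiC.congr [IsTopologicalAddGroup V] [ContinuousSMul ℝ V] {f g : V → W} {U : Set V}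
    (hf : IsBastianiC n f U) (hU : IsOpen U) (hfg : Set.EqOn f g U) : IsBastianiC n g U := by
  cases n with
  | zero => exact ContinuousOn.congr hf hfg.symm
  | succ n =>
    obtain ⟨hc, df, hd, hn⟩ := hf
    exact ⟨hc.congr hfg.symm, df, fun x hx h => (hd x hx h).congr_of_eqOn hU hx hfg, hn⟩

theorem IsBastianiC.clm_apply {W' : Type*} [AddCommGroup W'] [Module ℝ W'] [TopologicalSpace W']
    {f : V → W} {U : Set V} (hf : IsBastianiC n f U) (L : W →L[ℝ] W') :
    IsBastianiC n (fun x => L (f x)) U := by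
  induction n generalizing V with
  | zero => exact L.continuous.comp_continuousOn hf
  | succ n ih =>
    obtain ⟨hc, df, hd, hn⟩ := hf
    exact ⟨L.continuous.comp_continuousOn hc, fun p => L (df p),
      fun x hx h => (hd x hx h).clm_apply L, ih hn⟩

theorem IsBastianiC.comp_clm {V' : Type*} [AddCommGroup V'] [Module ℝ V'] [TopologicalSpace V']
    {f : V → W} {U : Set V} (hf : IsBastianiC n f U) (L : V' →L[ℝ] V) :
    IsBastianiC n (fun x => f (L x)) (L ⁻¹' U) := by
  induction n generalizing V V' with
  | zero => exact ContinuousOn.comp hf L.continuous.continuousOn fun x hx => hx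
  | succ n ih =>
    obtain ⟨hc, df, hd, hn⟩ := hf
    refine ⟨hc.comp L.continuous.continuousOn fun x hx => hx, fun p => df (L.prodMap L p),
      fun x hx h => ?_, ?_⟩
    · simpa [HasDirDeriv] using hd (L x) hx (L h)
    · convert! ih hn (L.prodMap L) using 1

theorem IsBastianiC.prodMk {W' : Type*} [AddCommGroup W'] [Module ℝ W'] [TopologicalSpace W']
    {f : V → W} {g : V → W'} {U : Set V} (hf : IsBastianiC n f U) (hg : IsBastianiC n g U) :
    IsBastianiC n (fun x => (f x, g x)) U := by
  induction n generalizing V with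
  | zero => exact ContinuousOn.prodMk hf hg
  | succ n ih =>
    obtain ⟨hc, df, hd, hn⟩ := hf
    obtain ⟨hc', dg, hd', hn'⟩ := hg
    exact ⟨hc.prodMk hc', fun p => (df p, dg p),
      fun x hx h => (hd x hx h).prodMk_nhds (hd' x hx h), ih hn hn'⟩

theorem IsBastianiC.add [IsTopologicalAddGroup W] {f g : V → W} {U : Set V}
    (hf : IsBastianiC n f U) (hg : IsBastianiC n g U) : IsBastianiC n (fun x => f x + g x) U :=
  (hf.prodMk hg).clm_apply (ContinuousLinearMap.fst ℝ W W + ContinuousLinearMap.snd ℝ W W)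

theorem IsBastianiC.sum [IsTopologicalAddGroup W] {ι : Type*} (I : Finset ι) {f : ι → V → W}
    {U : Set V} (h₀ : IsBastianiC n (fun _ => (0 : W)) U) (hf : ∀ i ∈ I, IsBastianiC n (f i) U) :
    IsBastianiC n (fun x => ∑ i ∈ I, f i x) U := by
  classical
  induction I using Finset.induction_on with
  | empty => simpa using h₀
  | insert i I hi ih =>
    simp only [Finset.sum_insert hi]
    exact (hf i (Finset.mem_insert_self _ _)).add
      (ih fun j hj => hf j (Finset.mem_insert_of_mem hj))

theorem isBastianiC_zero (U : Set V) : IsBastianiC n (fun _ : V => (0 : W)) U := by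
  induction n generalizing V with
  | zero => exact continuousOn_const
  | succ n ih =>
    exact ⟨continuousOn_const, fun _ => 0, fun x _ h => by simp [HasDirDeriv, tendsto_const_nhds],
      ih _⟩

theorem isBastianiC_const (c : W) (U : Set V) : IsBastianiC n (fun _ : V => c) U := by
  cases n with
  | zero => exact continuousOn_const
  | succ n =>
    exact ⟨continuousOn_const, fun _ => 0, fun x _ h => by simp [HasDirDeriv, tendsto_const_nhds],
      isBastianiC_zero _⟩

theorem ContinuousLinearMap.isBastianiC (L : V →L[ℝ] W) (U : Set V) :
    IsBastianiC n (fun x => L x) U := by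
  induction n generalizing V with
  | zero => exact L.continuous.continuousOn
  | succ n ih =>
    refine ⟨L.continuous.continuousOn, fun p => (L.comp (ContinuousLinearMap.snd ℝ V V)) p,
      fun x _ h => ?_, ih _ _⟩
    refine tendsto_const_nhds.congr' ?_
    filter_upwards [self_mem_nhdsWithin] with s hs
    simp [smul_smul, inv_mul_cancel₀ (show s ≠ 0 from hs)]

/-- The differential of g ∘ f is dg ∘ (f ∘ pr₁, df), again a composition but of one order less, so
the induction closes. -/
theorem IsBastianiC.comp {V' : Type*} [AddCommGroup V'] [Module ℝ V'] [TopologicalSpace V']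
    [IsTopologicalAddGroup V'] [ContinuousSMul ℝ V']
    [IsTopologicalAddGroup W] [ContinuousSMul ℝ W] [LocallyConvexSpace ℝ W]
    {g : V' → W} {f : V → V'} {U : Set V} {U' : Set V'} (hU' : IsOpen U')
    (hg : IsBastianiC n g U') (hf : IsBastianiC n f U) (hfU : Set.MapsTo f U U') :
    IsBastianiC n (fun x => g (f x)) U := by
  induction n generalizing V V' with
  | zero => exact ContinuousOn.comp hg hf hfU
  | succ n ih =>
    have hf' := hf.of_succ
    obtain ⟨hc, df, hd, hn⟩ := hf
    obtain ⟨hc', dg, hd', hn'⟩ := hg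
    refine ⟨hc'.comp hc hfU, fun p => dg (f p.1, df p), fun x hx h => ?_, ?_⟩
    · exact tendsto_slope_curve hU' hd' hn'.continuousOn (hfU hx) (hd x hx h)
    · refine ih (hU'.prod isOpen_univ) hn' (IsBastianiC.prodMk ?_ hn)
        fun p hp => ⟨hfU hp.1, Set.mem_univ _⟩
      refine (hf'.comp_clm (ContinuousLinearMap.fst ℝ V V)).mono fun p hp => hp.1

/-- Local differentials agree on overlaps because limits in a Hausdorff space are unique, so they
glue to one differential, to which the induction hypothesis applies. -/
theorem IsBastianiC.of_local [T2Space W] [IsTopologicalAddGroup V] [ContinuousSMul ℝ V]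
    {f : V → W} {U : Set V} (hU : IsOpen U)
    (hf : ∀ x ∈ U, ∃ O, IsOpen O ∧ x ∈ O ∧ IsBastianiC n f (U ∩ O)) : IsBastianiC n f U := by
  induction n generalizing V with
  | zero =>
    intro x hx
    obtain ⟨O, hO, hxO, hfO⟩ := hf x hx
    exact ((hfO.continuousOn x ⟨hx, hxO⟩).continuousAt
      ((hU.inter hO).mem_nhds ⟨hx, hxO⟩)).continuousWithinAt
  | succ n ih =>
    have hex : ∀ p : V × V, p.1 ∈ U → ∃ w, HasDirDeriv f p.1 p.2 w := fun p hp => by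
      obtain ⟨O, hO, hxO, -, df, hd, -⟩ := hf p.1 hp
      exact ⟨_, hd p.1 ⟨hp, hxO⟩ p.2⟩
    choose! df hdf using hex
    refine ⟨fun x hx => ?_, df, fun x hx h => hdf (x, h) hx, ih (hU.prod isOpen_univ) ?_⟩
    · obtain ⟨O, hO, hxO, hfO⟩ := hf x hx
      exact ((hfO.continuousOn x ⟨hx, hxO⟩).continuousAt
        ((hU.inter hO).mem_nhds ⟨hx, hxO⟩)).continuousWithinAt
    · rintro p ⟨hp, -⟩
      obtain ⟨O, hO, hxO, -, df', hd', hn⟩ := hf p.1 hp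
      refine ⟨O ×ˢ Set.univ, hO.prod isOpen_univ, ⟨hxO, Set.mem_univ _⟩, ?_⟩
      rw [Set.prod_inter_prod, Set.inter_univ]
      refine hn.congr ((hU.inter hO).prod isOpen_univ) fun q hq => ?_
      exact (hd' q.1 hq.1 q.2).unique (hdf q hq.1.1)

end Finite

/-! ### Equivalence of iterated directional derivatives and the recursive definition. -/

section Smooth

theorem continuous_fin_cons {X V : Type*} [TopologicalSpace X] [TopologicalSpace V] {k : ℕ}
    {f : X → V} {g : X → Fin k → V} (hf : Continuous f) (hg : Continuous g) :
    Continuous fun x => (Fin.cons (f x) (g x) : Fin (k + 1) → V) :=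
  continuous_pi fun j => Fin.cases hf (fun j => (continuous_apply j).comp hg) j

variable {V : Type u} [AddCommGroup V] [Module ℝ V] [TopologicalSpace V]
  [IsTopologicalAddGroup V] [ContinuousSMul ℝ V]
  {W : Type w} [AddCommGroup W] [Module ℝ W] [TopologicalSpace W] [T2Space W]

theorem bastianiSmoothOn_of_isBastianiC {f : V → W} {U : Set V} (hU : IsOpen U)
    (hf : ∀ n, IsBastianiC n f U) : BastianiSmoothOn f U := by
  classical
  -- The value 0 where no derivative exists is irrelevant: over `U` all the derivatives used below
  -- exist.
  let d : (V → W) → V → V → W := fun g x y =>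
    if hex : ∃ w, HasDirDeriv g x y w then hex.choose else 0
  have hd : ∀ {g : V → W} {x y : V} {w : W}, HasDirDeriv g x y w → d g x y = w := by
    intro g x y w hw
    have hex : ∃ w, HasDirDeriv g x y w := ⟨w, hw⟩
    simp only [d, dif_pos hex]
    exact hex.choose_spec.unique hw
  let D : (k : ℕ) → V → (Fin k → V) → W := fun k => Nat.rec (fun x _ => f x)
    (fun k Dk x h => d (fun z => Dk z (Fin.tail h)) x (h 0)) k
  have hD0 : ∀ x h, D 0 x h = f x := fun _ _ => rfl
  have hDs : ∀ k x h, D (k + 1) x h = d (fun z => D k z (Fin.tail h)) x (h 0) := fun _ _ _ => rfl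
  have hslice : ∀ k (dg : (V × (Fin k → V)) × (V × (Fin k → V)) → W),
      (∀ p ∈ U ×ˢ (Set.univ : Set (Fin k → V)), ∀ q,
        HasDirDeriv (fun p : V × (Fin k → V) => D k p.1 p.2) p q (dg (p, q))) →
      ∀ x ∈ U, ∀ (h : Fin k → V) (y : V),
        HasDirDeriv (fun z => D k z h) x y (dg ((x, h), (y, 0))) := by
    intro k dg hdg x hx h y
    simpa [HasDirDeriv] using hdg (x, h) ⟨hx, Set.mem_univ _⟩ (y, 0)
  -- Each iterated derivative is differentiable to every order jointly in point and directions,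
  -- since D (k + 1) is the differential of D k precomposed with the linear map `T`, which freezes
  -- the earlier directions.
  have key : ∀ k n, IsBastianiC n (fun p : V × (Fin k → V) => D k p.1 p.2) (U ×ˢ Set.univ) := by
    intro k
    induction k with
    | zero =>
      intro n
      exact ((hf n).comp_clm (ContinuousLinearMap.fst ℝ V (Fin 0 → V))).mono fun p hp => hp.1
    | succ k ih =>
      intro n
      obtain ⟨-, dg, hdg, hn⟩ := ih (n + 1)
      let T : V × (Fin (k + 1) → V) →L[ℝ] (V × (Fin k → V)) × (V × (Fin k → V)) :=
        ((ContinuousLinearMap.fst ℝ _ _).prod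
          (ContinuousLinearMap.pi fun j => (ContinuousLinearMap.proj j.succ).comp
            (ContinuousLinearMap.snd ℝ _ _))).prod
          (((ContinuousLinearMap.proj 0).comp (ContinuousLinearMap.snd ℝ _ _)).prod 0)
      refine ((hn.comp_clm T).mono (U' := U ×ˢ Set.univ)
        fun p hp => ⟨⟨hp.1, Set.mem_univ _⟩, Set.mem_univ _⟩).congr (hU.prod isOpen_univ)
        fun p hp => ?_
      simp only [hDs]
      exact (hd (hslice k dg hdg p.1 hp.1 (Fin.tail p.2) (p.2 0))).symm
  refine ⟨D, fun x _ h => rfl, fun k x hx h y => ?_, fun k => key k 0⟩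
  obtain ⟨-, dg, hdg, -⟩ := key k 1
  have h1 := hslice k dg hdg x hx h y
  rw [hDs, Fin.tail_cons, Fin.cons_zero, hd h1]
  exact h1

variable [IsTopologicalAddGroup W] [ContinuousSMul ℝ W] [LocallyConvexSpace ℝ W]

/-- Iterated directional derivatives are linear in each direction. -/
theorem iteratedDirDeriv_update {U : Set V} (hU : IsOpen U) {D : (k : ℕ) → V → (Fin k → V) → W}
    (hD : ∀ k : ℕ, ∀ x ∈ U, ∀ (h : Fin k → V) (y : V),
      HasDirDeriv (fun z => D k z h) x y (D (k + 1) x (Fin.cons y h : Fin (k + 1) → V)))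
    (hc : ∀ k : ℕ, ContinuousOn (fun p : V × (Fin k → V) => D k p.1 p.2) (U ×ˢ Set.univ)) (k : ℕ) :
    ∀ x ∈ U, ∀ (h : Fin k → V) (i : Fin k),
      (∀ a b, D k x (Function.update h i (a + b))
        = D k x (Function.update h i a) + D k x (Function.update h i b)) ∧
      ∀ (c : ℝ) (a : V), D k x (Function.update h i (c • a)) = c • D k x (Function.update h i a) := by
  induction k with
  | zero => exact fun x _ h i => i.elim0
  | succ k ih =>
    intro x hx h i
    induction h using Fin.consCases with
    | _ y t =>
    induction i using Fin.cases with
    | zero =>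
      simp only [Fin.update_cons_zero]
      have hc' : ContinuousOn (fun p : V × V => D (k + 1) p.1 (Fin.cons p.2 t : Fin (k + 1) → V))
          (U ×ˢ Set.univ) := by
        refine (hc (k + 1)).comp (f := fun p : V × V => (p.1, (Fin.cons p.2 t : Fin (k + 1) → V)))
          (continuous_fst.prodMk (continuous_fin_cons continuous_snd continuous_const)).continuousOn
          fun p hp => ⟨hp.1, Set.mem_univ _⟩
      exact ⟨fun a b => dirDeriv_add (f := fun z => D k z t)
          (df := fun p => D (k + 1) p.1 (Fin.cons p.2 t : Fin (k + 1) → V)) hU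
          (fun z hz h => hD k z hz t h) hc' hx a b,
        fun c a => dirDeriv_smul (f := fun z => D k z t)
          (df := fun p => D (k + 1) p.1 (Fin.cons p.2 t : Fin (k + 1) → V))
          (fun z hz h => hD k z hz t h) hx c a⟩
    | succ i =>
      simp only [← Fin.cons_update]
      refine ⟨fun a b => ?_, fun c a => ?_⟩
      -- Linearity in the earlier directions survives differentiation: the identity for D k holds on
      -- the open set `U` and can be differentiated there.
      · refine (hD k x hx _ y).unique (HasDirDeriv.congr_of_eqOn
          ((hD k x hx (Function.update t i a) y).add (hD k x hx (Function.update t i b) y)) hU hx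
          fun z hz => ((ih z hz t i).1 a b).symm)
      · refine (hD k x hx _ y).unique (HasDirDeriv.congr_of_eqOn
          ((hD k x hx (Function.update t i a) y).smul_const c) hU hx
          fun z hz => ((ih z hz t i).2 c a).symm)

theorem hasDirDeriv_iteratedDirDeriv {U : Set V} (hU : IsOpen U)
    {D : (k : ℕ) → V → (Fin k → V) → W}
    (hD : ∀ k : ℕ, ∀ x ∈ U, ∀ (h : Fin k → V) (y : V),
      HasDirDeriv (fun z => D k z h) x y (D (k + 1) x (Fin.cons y h : Fin (k + 1) → V)))
    (hc : ∀ k : ℕ, ContinuousOn (fun p : V × (Fin k → V) => D k p.1 p.2) (U ×ˢ Set.univ)) (k : ℕ)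
    {x : V} (hx : x ∈ U) (h : Fin k → V) (y : V) (h' : Fin k → V) :
    HasDirDeriv (fun p : V × (Fin k → V) => D k p.1 p.2) (x, h) (y, h')
      (D (k + 1) x (Fin.cons y h : Fin (k + 1) → V)
        + ∑ i, D k x (Function.update h i (h' i))) := by
  have hO : IsOpen (U ×ˢ (Set.univ : Set (Fin k → V))) := hU.prod isOpen_univ
  have hlin := iteratedDirDeriv_update hU hD hc k
  -- One summand moves the base point, and each other summand moves a single direction, in which D k
  -- is linear.
  have hdec : (y, h') = (y, (0 : Fin k → V)) + ∑ i, ((0 : V), Pi.single i (h' i)) := by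
    refine Prod.ext ?_ ?_
    · simp [Prod.fst_sum]
    · simp [Prod.snd_sum, Finset.univ_sum_single]
  have hcA : ContinuousOn (fun p : V × (Fin k → V) =>
      D (k + 1) p.1 (Fin.cons y p.2 : Fin (k + 1) → V)) (U ×ˢ Set.univ) :=
    (hc (k + 1)).comp (f := fun p : V × (Fin k → V) => (p.1, (Fin.cons y p.2 : Fin (k + 1) → V)))
      (continuous_fst.prodMk (continuous_fin_cons continuous_const continuous_snd)).continuousOn
      fun p hp => ⟨hp.1, Set.mem_univ _⟩
  have hcB : ∀ i, ContinuousOn (fun p : V × (Fin k → V) =>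
      D k p.1 (Function.update p.2 i (h' i))) (U ×ˢ Set.univ) := fun i =>
    (hc k).comp (f := fun p : V × (Fin k → V) => (p.1, Function.update p.2 i (h' i)))
      (continuous_fst.prodMk (continuous_snd.update i continuous_const)).continuousOn
      fun p hp => ⟨hp.1, Set.mem_univ _⟩
  have hdA : ∀ p ∈ U ×ˢ (Set.univ : Set (Fin k → V)),
      HasDirDeriv (fun p : V × (Fin k → V) => D k p.1 p.2) p (y, 0)
        (D (k + 1) p.1 (Fin.cons y p.2 : Fin (k + 1) → V)) := fun p hp => by
    refine (hD k p.1 hp.1 p.2 y).congr fun s => ?_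
    beta_reduce
    rw [Prod.fst_add, Prod.snd_add, Prod.smul_fst, Prod.smul_snd, smul_zero, add_zero]
  have hdB : ∀ i, ∀ p ∈ U ×ˢ (Set.univ : Set (Fin k → V)),
      HasDirDeriv (fun p : V × (Fin k → V) => D k p.1 p.2) p (0, Pi.single i (h' i))
        (D k p.1 (Function.update p.2 i (h' i))) := fun i p hp => by
    refine tendsto_const_nhds.congr' ?_
    filter_upwards [self_mem_nhdsWithin] with s hs
    have e : p.2 + s • (Pi.single i (h' i) : Fin k → V) = Function.update p.2 i (p.2 i + s • h' i) := by
      ext j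
      by_cases hj : j = i
      · subst hj; simp
      · simp [hj]
    rw [Prod.fst_add, Prod.snd_add, Prod.smul_fst, Prod.smul_snd, smul_zero, add_zero, e,
      (hlin p.1 hp.1 p.2 i).1, (hlin p.1 hp.1 p.2 i).2, Function.update_eq_self,
      add_sub_cancel_left, smul_smul, inv_mul_cancel₀ (show s ≠ 0 from hs), one_smul]
  rw [hdec]
  exact HasDirDeriv.add_dir hO hdA hcA ⟨hx, Set.mem_univ _⟩
    (HasDirDeriv.sum_dir (df := fun i p => D k p.1 (Function.update p.2 i (h' i)))
      Finset.univ hO (fun i _ => hdB i) (fun i _ => hcB i) ⟨hx, Set.mem_univ _⟩)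

/-- The joint differential of D k is a sum of D (k + 1) and copies of D k, each precomposed with a
continuous linear map; induction on the order for all `k` at once therefore works. -/
theorem isBastianiC_iteratedDirDeriv {U : Set V} (hU : IsOpen U)
    {D : (k : ℕ) → V → (Fin k → V) → W}
    (hD : ∀ k : ℕ, ∀ x ∈ U, ∀ (h : Fin k → V) (y : V),
      HasDirDeriv (fun z => D k z h) x y (D (k + 1) x (Fin.cons y h : Fin (k + 1) → V)))
    (hc : ∀ k : ℕ, ContinuousOn (fun p : V × (Fin k → V) => D k p.1 p.2) (U ×ˢ Set.univ)) (n : ℕ) :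
    ∀ k, IsBastianiC n (fun p : V × (Fin k → V) => D k p.1 p.2) (U ×ˢ Set.univ) := by
  induction n with
  | zero => exact hc
  | succ n ih =>
    intro k
    let A : (V × (Fin k → V)) × (V × (Fin k → V)) →L[ℝ] V × (Fin (k + 1) → V) :=
      ⟨⟨⟨fun q => (q.1.1, (Fin.cons q.2.1 q.1.2 : Fin (k + 1) → V)), fun p q => by
        refine Prod.ext rfl (funext fun j => ?_)
        exact Fin.cases rfl (fun j => rfl) j⟩, fun c q => by
        refine Prod.ext rfl (funext fun j => ?_)
        exact Fin.cases rfl (fun j => rfl) j⟩,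
        (continuous_fst.comp continuous_fst).prodMk (continuous_fin_cons
          (continuous_fst.comp continuous_snd) (continuous_snd.comp continuous_fst))⟩
    let B : Fin k → (V × (Fin k → V)) × (V × (Fin k → V)) →L[ℝ] V × (Fin k → V) := fun i =>
      ⟨⟨⟨fun q => (q.1.1, Function.update q.1.2 i (q.2.2 i)), fun p q =>
          Prod.ext rfl (Function.update_add _ _ _ _ _)⟩, fun c q =>
          Prod.ext rfl (Function.update_smul _ _ _ _)⟩,
        (continuous_fst.comp continuous_fst).prodMk ((continuous_snd.comp continuous_fst).update i
          ((continuous_apply i).comp (continuous_snd.comp continuous_snd)))⟩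
    refine ⟨hc k, fun q => D (k + 1) (A q).1 (A q).2 + ∑ i, D k (B i q).1 (B i q).2, ?_, ?_⟩
    · rintro ⟨x, h⟩ ⟨hx, -⟩ ⟨y, h'⟩
      exact hasDirDeriv_iteratedDirDeriv hU hD hc k hx h y h'
    · refine IsBastianiC.add ?_ (IsBastianiC.sum _ (isBastianiC_zero _) fun i _ => ?_)
      · exact ((ih (k + 1)).comp_clm A).mono fun q hq => ⟨hq.1.1, Set.mem_univ _⟩
      · exact ((ih k).comp_clm (B i)).mono fun q hq => ⟨hq.1.1, Set.mem_univ _⟩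

theorem BastianiSmoothOn.isBastianiC {f : V → W} {U : Set V} (hU : IsOpen U)
    (hf : BastianiSmoothOn f U) (n : ℕ) : IsBastianiC n f U := by
  obtain ⟨D, h0, hD, hc⟩ := hf
  have h1 := ((isBastianiC_iteratedDirDeriv hU hD hc n 0).comp_clm
    (ContinuousLinearMap.inl ℝ V (Fin 0 → V))).mono (U' := U) fun x hx => ⟨hx, Set.mem_univ _⟩
  exact h1.congr hU fun x hx => h0 x hx _

theorem bastianiSmoothOn_iff {f : V → W} {U : Set V} (hU : IsOpen U) :
    BastianiSmoothOn f U ↔ ∀ n, IsBastianiC n f U :=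
  ⟨fun h n => h.isBastianiC hU n, bastianiSmoothOn_of_isBastianiC hU⟩

end Smooth

/-! ### From Arveson spectral subspaces to distributional Fourier support. -/

section Spectrum

open scoped FourierTransform
open FourierTransform

theorem hat_eq_fourierInv (f : ℝ → ℂ) (ξ : ℝ) : hat f (2 * Real.pi * ξ) = 𝓕⁻ f ξ := by
  rw [Real.fourierInv_eq', hat]
  refine integral_congr_ae (ae_of_all _ fun x => ?_)
  simp only [smul_eq_mul, RCLike.inner_apply, conj_trivial]
  rw [mul_comm]
  congr 2
  push_cast
  ring

/-- The homeomorphism `ξ ↦ 2πξ` relating the two normalizations of the Fourier transform. -/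
noncomputable def twoPi : ℝ ≃ₜ ℝ := Homeomorph.mulLeft₀ (2 * Real.pi) (by positivity)

theorem twoPi_apply (ξ : ℝ) : twoPi ξ = 2 * Real.pi * ξ := rfl

theorem compl_closure_preimage_twoPi {E : Set ℝ} {ξ : ℝ} (h : ξ ∈ (closure (twoPi ⁻¹' E))ᶜ) :
    2 * Real.pi * ξ ∉ closure E := by
  rwa [← twoPi.preimage_closure, Set.mem_compl_iff, Set.mem_preimage, twoPi_apply] at h

variable {V : Type*} [AddCommGroup V] [Module ℂ V] [TopologicalSpace V] {α : ℝ → V → V}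

/-- For `α` acting by continuous linear operators, annihilators are translation invariant. -/
theorem exists_annihilator (hlin : ∀ t, ∃ L : V →L[ℂ] V, ∀ x, α t x = L x)
    (hadd : ∀ s t x, α (s + t) x = α s (α t x)) {A : Set (ℝ → ℂ)} {y : V} {E : Set ℝ}
    (hy : y ∈ spectralSubspace A α E) {ξ : ℝ} (hξ : ξ ∈ (closure (twoPi ⁻¹' E))ᶜ) :
    ∃ f ∈ A, 𝓕⁻ f ξ ≠ 0 ∧ ∀ l : V →L[ℂ] ℂ, ∀ r, ∫ t, f t * l (α (t + r) y) = 0 := by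
  have h1 : 2 * Real.pi * ξ ∉ arvesonSpec A α y :=
    fun h => compl_closure_preimage_twoPi hξ (hy h)
  simp only [arvesonSpec, Set.mem_ofPred_eq, not_forall] at h1
  obtain ⟨f, hfA, hf, hne⟩ := h1
  rw [hat_eq_fourierInv] at hne
  refine ⟨f, hfA, hne, fun l r => ?_⟩
  obtain ⟨L, hL⟩ := hlin r
  have h2 := (hf (l.comp L)).2
  rw [map_zero] at h2
  rw [← h2]
  refine integral_congr_ae (ae_of_all _ fun t => ?_)
  simp only [ContinuousLinearMap.comp_apply, map_smul, smul_eq_mul, ← hL, ← hadd, add_comm r]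

/-- Off the closure of `E` every frequency has an integrable annihilator with nonzero transform
there; the local Wiener argument applies because the matrix coefficient is bounded. -/
theorem FourierVanishes.of_mem_spectralSubspace_integrable
    (hlin : ∀ t, ∃ L : V →L[ℂ] V, ∀ x, α t x = L x)
    (hadd : ∀ s t x, α (s + t) x = α s (α t x)) {y : V} (hcont : Continuous fun t => α t y)
    {E : Set ℝ} (hy : y ∈ spectralSubspace L1Functions α E) (l : V →L[ℂ] ℂ)
    {B : ℝ} (hB : ∀ t, ‖l (α t y)‖ ≤ B) :
    FourierVanishes (fun t => l (α t y)) (closure (twoPi ⁻¹' E))ᶜ := by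
  have hc : Continuous fun t => l (α t y) := l.continuous.comp hcont
  refine FourierVanishes.of_local ⟨hc, B, 0, by simpa using hB⟩ fun ξ hξ => ?_
  obtain ⟨f, hfA, hne, hf⟩ := exists_annihilator hlin hadd hy hξ
  exact FourierVanishes.of_integrable hc hB hfA (hf l) hne

/-- With Schwartz annihilators, division of test functions replaces the Wiener argument, so
polynomial growth of the matrix coefficient is enough. -/
theorem FourierVanishes.of_mem_spectralSubspace_schwartz
    (hlin : ∀ t, ∃ L : V →L[ℂ] V, ∀ x, α t x = L x)
    (hadd : ∀ s t x, α (s + t) x = α s (α t x)) {y : V}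
    {E : Set ℝ} (hy : y ∈ spectralSubspace SchwartzFunctions α E) (l : V →L[ℂ] ℂ)
    (hl : IsPolyGrowth fun t => l (α t y)) :
    FourierVanishes (fun t => l (α t y)) (closure (twoPi ⁻¹' E))ᶜ := by
  refine FourierVanishes.of_local hl fun ξ hξ => ?_
  obtain ⟨_, ⟨f, rfl⟩, hne, hf⟩ := exists_annihilator hlin hadd hy hξ
  rw [← SchwartzMap.fourierInv_coe] at hne
  exact ⟨_, (isOpen_ne_fun (𝓕⁻ f).continuous continuous_const).mem_nhds hne,
    FourierVanishes.of_schwartz hl f (hf l)⟩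

theorem exists_pos_smul_mem_of_nhds_zero [ContinuousSMul ℂ V] (y : V) {W : Set V}
    (hW : W ∈ 𝓝 (0 : V)) : ∃ r : ℝ, 0 < r ∧ (r : ℂ) • y ∈ W := by
  have hc : Continuous fun r : ℝ => (r : ℂ) • y := by fun_prop
  have h1 : Tendsto (fun r : ℝ => (r : ℂ) • y) (𝓝[>] 0) (𝓝 0) := by
    simpa using (hc.tendsto 0).mono_left nhdsWithin_le_nhds
  obtain ⟨r, h2, h3⟩ := ((h1.eventually hW).and self_mem_nhdsWithin).exists
  exact ⟨r, h3, h2⟩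

theorem IsEquicontinuous.exists_bound [ContinuousSMul ℂ V] (hα : IsEquicontinuous α)
    (hlin : ∀ t, ∃ L : V →L[ℂ] V, ∀ x, α t x = L x) (p : Seminorm ℂ V) (hp : Continuous p) (y : V) :
    ∃ C : ℝ, ∀ t, p (α t y) ≤ C := by
  obtain ⟨W, hW, hWt⟩ := hα {x | p x < 1} ((isOpen_lt hp continuous_const).mem_nhds (by simp))
  obtain ⟨r, hr, hrW⟩ := exists_pos_smul_mem_of_nhds_zero y hW
  refine ⟨r⁻¹, fun t => ?_⟩
  obtain ⟨L, hL⟩ := hlin t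
  have h := hWt t _ hrW
  rw [Set.mem_ofPred_eq, hL, map_smul, ← hL, map_smul_eq_mul, Complex.norm_real,
    Real.norm_of_nonneg hr.le] at h
  rw [← one_div, le_div_iff₀ hr, mul_comm]
  exact h.le

theorem IsPolynomiallyBounded.exists_bound [ContinuousSMul ℂ V] (hα : IsPolynomiallyBounded α)
    (hlin : ∀ t, ∃ L : V →L[ℂ] V, ∀ x, α t x = L x) (p : Seminorm ℂ V) (hp : Continuous p) (y : V) :
    ∃ (C : ℝ) (N : ℕ), ∀ t, p (α t y) ≤ C * (1 + |t|) ^ N := by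
  obtain ⟨N, hN⟩ := hα p hp
  obtain ⟨W, hW, hWt⟩ := hN 1 one_pos
  obtain ⟨r, hr, hrW⟩ := exists_pos_smul_mem_of_nhds_zero y hW
  refine ⟨r⁻¹ * 2, N, fun t => ?_⟩
  obtain ⟨L, hL⟩ := hlin t
  have h := hWt t _ hrW
  have hpos : 0 < 1 + |t| ^ N := by positivity
  rw [hL, L.map_smul, ← hL, map_smul_eq_mul, map_smul_eq_mul, Complex.norm_real, Complex.norm_real,
    Real.norm_of_nonneg hr.le, Real.norm_of_nonneg (by positivity), inv_mul_lt_iff₀ hpos,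
    mul_one] at h
  have h1 : |t| ^ N ≤ (1 + |t|) ^ N :=
    pow_le_pow_left₀ (abs_nonneg t) (by linarith) N
  have h2 : 1 ≤ (1 + |t|) ^ N := one_le_pow₀ (by simp)
  rw [mul_assoc, ← div_eq_inv_mul, le_div_iff₀ hr, mul_comm]
  linarith

/-- Functions with prescribed value at a point whose Fourier transform is supported near it. -/
theorem exists_schwartz_tsupport_subset {O : Set ℝ} {ξ : ℝ} (hO : O ∈ 𝓝 ξ) :
    ∃ k : 𝓢(ℝ, ℂ), HasCompactSupport k ∧ tsupport k ⊆ O ∧ k ξ = 1 := by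
  obtain ⟨c, hc, hcO⟩ := Metric.nhds_basis_closedBall.mem_iff.1 hO
  have hc2 : 0 < c / 2 := half_pos hc
  refine ⟨rescale (c / 2) ξ hc2 plateau, hasCompactSupport_rescale_plateau _ _ hc2,
    (tsupport_rescale_plateau_subset _ _ hc2).trans ?_, rescale_plateau_eq_one hc2 (by simp [hc2.le])⟩
  rwa [mul_div_cancel₀ _ two_ne_zero]

end Spectrum

/-! ### Topology of the complexification. -/

section ComplexificationTopology

variable {𝔤 : Type*} [TopologicalSpace 𝔤]

theorem Complexification.continuous_re : Continuous (Complexification.re (𝔤 := 𝔤)) :=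
  continuous_fst (X := 𝔤) (Y := 𝔤)

theorem Complexification.continuous_im : Continuous (Complexification.im (𝔤 := 𝔤)) :=
  continuous_snd (X := 𝔤) (Y := 𝔤)

instance [AddCommGroup 𝔤] [Module ℝ 𝔤] [IsTopologicalAddGroup 𝔤] [ContinuousSMul ℝ 𝔤] :
    ContinuousSMul ℂ (Complexification 𝔤) where
  continuous_smul := by
    have h1 := Complexification.continuous_re (𝔤 := 𝔤)
    have h2 := Complexification.continuous_im (𝔤 := 𝔤)
    have hr : Continuous fun p : ℂ × Complexification 𝔤 => p.1.re • p.2.re - p.1.im • p.2.im :=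
      ((Complex.continuous_re.comp continuous_fst).smul (h1.comp continuous_snd)).sub
        ((Complex.continuous_im.comp continuous_fst).smul (h2.comp continuous_snd))
    have hi : Continuous fun p : ℂ × Complexification 𝔤 => p.1.re • p.2.im + p.1.im • p.2.re :=
      ((Complex.continuous_re.comp continuous_fst).smul (h2.comp continuous_snd)).add
        ((Complex.continuous_im.comp continuous_fst).smul (h1.comp continuous_snd))
    exact hr.prodMk hi

end ComplexificationTopology

theorem chartAt_mem_target {X M : Type*} [TopologicalSpace X] [TopologicalSpace M]
    [ChartedSpace X M] (g : M) : chartAt X g g ∈ (chartAt X g).target :=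
  (chartAt X g).map_source (mem_chart_source X g)

/-! ### Differentials at the identity and the action on the Lie algebra. -/

section Velocity

variable {𝔤 : Type*} [AddCommGroup 𝔤] [Module ℝ 𝔤] [TopologicalSpace 𝔤]
  {G : Type*} [TopologicalSpace G] [ChartedSpace 𝔤 G] [Group G]

/-- The curve `c` in `G` tends to `1`, with velocity `h` in the preferred chart at `1`. -/
def HasVelocity (c : ℝ → G) (h : 𝔤) : Prop :=
  Tendsto c (𝓝[≠] 0) (𝓝 1) ∧
    Tendsto (fun s : ℝ => s⁻¹ • (chartAt 𝔤 (1 : G) (c s) - chartAt 𝔤 (1 : G) 1)) (𝓝[≠] 0) (𝓝 h)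

theorem IsSmoothExp.map_zero {exp : 𝔤 → G} (hexp : IsSmoothExp exp) : exp 0 = 1 := by
  have h := hexp.map_add 0 0 0
  simpa using h

theorem IsSmoothExp.map_neg {exp : 𝔤 → G} (hexp : IsSmoothExp exp) (x : 𝔤) :
    exp (-x) = (exp x)⁻¹ := by
  have h := hexp.map_add x (-1) 1
  rw [eq_inv_iff_mul_eq_one]
  simpa [hexp.map_zero] using h.symm

theorem IsSmoothExp.hasVelocity [ContinuousSMul ℝ 𝔤] {exp : 𝔤 → G}
    (hexp : IsSmoothExp exp) (x : 𝔤) :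
    HasVelocity (fun s : ℝ => exp (s • x)) x := by
  refine ⟨?_, ?_⟩
  · have h : Continuous fun s : ℝ => exp (s • x) := hexp.continuous.comp (by fun_prop)
    simpa [hexp.map_zero] using (h.tendsto 0).mono_left nhdsWithin_le_nhds
  · simpa [HasDirDeriv, hexp.map_zero] using hexp.velocity x

variable [IsTopologicalAddGroup 𝔤] [ContinuousSMul ℝ 𝔤]

theorem hasVelocity_ray (x : 𝔤) :
    HasVelocity (G := G) (fun s : ℝ => (chartAt 𝔤 (1 : G)).symm (chartAt 𝔤 (1 : G) 1 + s • x)) x := by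
  set e := chartAt 𝔤 (1 : G) with he
  have hc : Continuous fun s : ℝ => e 1 + s • x := by fun_prop
  have ht : Tendsto (fun s : ℝ => e 1 + s • x) (𝓝[≠] 0) (𝓝 (e 1)) := by
    simpa using (hc.tendsto 0).mono_left nhdsWithin_le_nhds
  have hmem : e 1 ∈ e.target := chartAt_mem_target 1
  refine ⟨?_, ?_⟩
  · have := (e.continuousAt_symm hmem).tendsto.comp ht
    rwa [e.left_inv (mem_chart_source 𝔤 1)] at this
  · refine tendsto_const_nhds.congr' ?_
    filter_upwards [self_mem_nhdsWithin, ht (e.open_target.mem_nhds hmem)] with s hs hst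
    rw [← he, e.right_inv hst, add_sub_cancel_left, smul_smul,
      inv_mul_cancel₀ (show s ≠ 0 from hs), one_smul]

/-- The differential at `1` of a function which is smooth near `1`. -/
theorem exists_differential {W : Type*} [AddCommGroup W] [Module ℝ W] [TopologicalSpace W]
    [IsTopologicalAddGroup W] [ContinuousSMul ℝ W] [LocallyConvexSpace ℝ W] [T2Space W]
    {F : G → W} {U : Set 𝔤} (hU : IsOpen U) (h1 : chartAt 𝔤 (1 : G) 1 ∈ U)
    (hF : BastianiSmoothOn (fun x => F ((chartAt 𝔤 (1 : G)).symm x)) U) :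
    ∃ L : 𝔤 →L[ℝ] W, ∀ (c : ℝ → G) (h : 𝔤), HasVelocity c h →
      Tendsto (fun s : ℝ => s⁻¹ • (F (c s) - F 1)) (𝓝[≠] 0) (𝓝 (L h)) := by
  set e := chartAt 𝔤 (1 : G) with he
  obtain ⟨-, df, hd, hdc⟩ := hF.isBastianiC hU 1
  refine ⟨⟨⟨⟨fun h => df (e 1, h), dirDeriv_add hU hd hdc h1⟩, dirDeriv_smul hd h1⟩, ?_⟩,
    fun c h hc => ?_⟩
  · exact continuousOn_univ.1 (hdc.continuousOn.comp (f := fun h : 𝔤 => (e 1, h))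
      (by fun_prop) fun h _ => ⟨h1, Set.mem_univ _⟩)
  · refine (tendsto_slope_curve hU hd hdc.continuousOn h1 hc.2).congr' ?_
    filter_upwards [hc.1 (e.open_source.mem_nhds (mem_chart_source 𝔤 1))] with s hs
    rw [← he, e.left_inv hs, e.left_inv (mem_chart_source 𝔤 1)]

variable [LocallyConvexSpace ℝ 𝔤] [T2Space 𝔤]

/-- Since `lieMap` is defined through chart rays only, the action on arbitrary curves through 1 is
recorded too; it gives functoriality in `lieMap_mul`. -/
theorem exists_lieMap {φ : MulAut G} (hφ : IsLieAut 𝔤 φ) :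
    ∃ L : 𝔤 →L[ℝ] 𝔤, (∀ x, lieMap φ x = L x) ∧
      ∀ (c : ℝ → G) (h : 𝔤), HasVelocity c h → HasVelocity (fun s => φ (c s)) (L h) := by
  set e := chartAt 𝔤 (1 : G) with he
  have hU : IsOpen {x | x ∈ e.target ∧ φ (e.symm x) ∈ e.source} :=
    e.isOpen_inter_preimage_symm (e.open_source.preimage hφ.1.continuous)
  have h1 : e 1 ∈ {x | x ∈ e.target ∧ φ (e.symm x) ∈ e.source} := by
    refine ⟨chartAt_mem_target 1, ?_⟩
    rw [e.left_inv (mem_chart_source 𝔤 1), map_one]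
    exact mem_chart_source 𝔤 1
  obtain ⟨L, hL⟩ := exists_differential (F := fun g => e (φ g)) hU h1
    (hφ.1.smooth e (chart_mem_atlas 𝔤 1) e (chart_mem_atlas 𝔤 1))
  simp only [map_one] at hL
  refine ⟨L, fun x => (hL _ x (hasVelocity_ray x)).limUnder_eq, fun c h hc => ⟨?_, hL c h hc⟩⟩
  have := (hφ.1.continuous.tendsto 1).comp hc.1
  simpa only [map_one, Function.comp_def] using this

theorem lieMap_mul {φ ψ : MulAut G} (hφ : IsLieAut 𝔤 φ) (hψ : IsLieAut 𝔤 ψ)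
    (hφψ : IsLieAut 𝔤 (φ * ψ)) (x : 𝔤) : lieMap (φ * ψ) x = lieMap φ (lieMap ψ x) := by
  obtain ⟨L, hL, hLc⟩ := exists_lieMap hφ
  obtain ⟨L', hL', hLc'⟩ := exists_lieMap hψ
  obtain ⟨L'', hL'', hLc''⟩ := exists_lieMap hφψ
  rw [hL, hL', hL'']
  have hx := hasVelocity_ray (G := G) x
  exact tendsto_nhds_unique (hLc'' _ _ hx).2 (hLc _ _ (hLc' _ _ hx)).2

theorem complexAction_linear {γ : Multiplicative ℝ →* MulAut G} (hγ : ∀ t, IsLieAut 𝔤 (γ t))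
    (t : ℝ) : ∃ L : Complexification 𝔤 →L[ℂ] Complexification 𝔤,
      ∀ y, complexAction 𝔤 γ t y = L y := by
  obtain ⟨L, hL, -⟩ := exists_lieMap (hγ (Multiplicative.ofAdd t))
  refine ⟨⟨⟨⟨fun y => Complexification.mk (L y.re) (L y.im), fun x y => ?_⟩, fun c y => ?_⟩, ?_⟩,
    fun y => ?_⟩
  · exact Complexification.ext' (map_add L _ _) (map_add L _ _)
  · refine Complexification.ext' ?_ ?_
    · change L (c.re • y.re - c.im • y.im) = c.re • L y.re - c.im • L y.im
      simp
    · change L (c.re • y.im + c.im • y.re) = c.re • L y.im + c.im • L y.re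
      simp
  · exact Continuous.prodMk (L.continuous.comp Complexification.continuous_re)
      (L.continuous.comp Complexification.continuous_im)
  · exact Complexification.ext' (hL _) (hL _)

theorem complexAction_add {γ : Multiplicative ℝ →* MulAut G} (hγ : ∀ t, IsLieAut 𝔤 (γ t))
    (s t : ℝ) (y : Complexification 𝔤) :
    complexAction 𝔤 γ (s + t) y = complexAction 𝔤 γ s (complexAction 𝔤 γ t y) := by
  have h : ∀ x : 𝔤, lieMap (γ (Multiplicative.ofAdd (s + t))) x = lieMap
      (γ (Multiplicative.ofAdd s)) (lieMap (γ (Multiplicative.ofAdd t)) x) := fun x => by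
    have h1 := hγ (Multiplicative.ofAdd (s + t))
    rw [ofAdd_add, map_mul] at h1 ⊢
    exact lieMap_mul (hγ _) (hγ _) h1 x
  exact Complexification.ext' (h _) (h _)

end Velocity

/-! ### Commutation relations in the semidirect product. -/

section Covariance

variable {G : Type*} [Group G] {H : Type*} [NormedAddCommGroup H] [InnerProductSpace ℂ H]
  {γ : Multiplicative ℝ →* MulAut G}

theorem repG_repU (ρ : G ⋊[γ] Multiplicative ℝ →* (H ≃ₗᵢ[ℂ] H)) (g : G) (t : ℝ) (v : H) :
    repG ρ g (repU ρ t v) = repU ρ t (repG ρ (γ (Multiplicative.ofAdd (-t)) g) v) := by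
  have h : (SemidirectProduct.inl g * SemidirectProduct.inr (Multiplicative.ofAdd t) :
      G ⋊[γ] Multiplicative ℝ) = SemidirectProduct.inr (Multiplicative.ofAdd t) *
        SemidirectProduct.inl (γ (Multiplicative.ofAdd (-t)) g) := by
    ext <;> simp
  have h2 := congrArg (fun a => ρ a v) h
  simpa [repG, repU] using h2

theorem repU_repG (ρ : G ⋊[γ] Multiplicative ℝ →* (H ≃ₗᵢ[ℂ] H)) (g : G) (t : ℝ) (v : H) :
    repU ρ t (repG ρ g v) = repG ρ (γ (Multiplicative.ofAdd t) g) (repU ρ t v) := by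
  rw [repG_repU, ← MulAut.mul_apply, ← map_mul, ← ofAdd_add]
  simp

theorem repU_add (ρ : G ⋊[γ] Multiplicative ℝ →* (H ≃ₗᵢ[ℂ] H)) (s t : ℝ) (v : H) :
    repU ρ (s + t) v = repU ρ s (repU ρ t v) := by
  simp [repU, ofAdd_add]

theorem norm_repU (ρ : G ⋊[γ] Multiplicative ℝ →* (H ≃ₗᵢ[ℂ] H)) (t : ℝ) (v : H) :
    ‖repU ρ t v‖ = ‖v‖ :=
  LinearIsometryEquiv.norm_map _ v

theorem repU_linear (ρ : G ⋊[γ] Multiplicative ℝ →* (H ≃ₗᵢ[ℂ] H)) (t : ℝ) :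
    ∃ L : H →L[ℂ] H, ∀ v, repU ρ t v = L v :=
  ⟨(ρ (SemidirectProduct.inr (Multiplicative.ofAdd t))).toContinuousLinearEquiv, fun _ => rfl⟩

theorem IsContinuousUnitaryRep.continuous_repU [TopologicalSpace G]
    {ρ : G ⋊[γ] Multiplicative ℝ →* (H ≃ₗᵢ[ℂ] H)} (hρ : IsContinuousUnitaryRep ρ) (v : H) :
    Continuous fun t => repU ρ t v :=
  (hρ v).comp (f := fun t : ℝ => ((1 : G), t)) (by fun_prop)

end Covariance

/-! ### Invariance of the smooth vectors. -/

section SmoothVectors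

variable {𝔤 : Type*} [AddCommGroup 𝔤] [Module ℝ 𝔤] [TopologicalSpace 𝔤]
  [IsTopologicalAddGroup 𝔤] [ContinuousSMul ℝ 𝔤]
  {G : Type*} [TopologicalSpace G] [ChartedSpace 𝔤 G] [Group G]
  {H : Type*} [NormedAddCommGroup H] [InnerProductSpace ℂ H]

theorem smoothVectors_add {π : G →* (H ≃ₗᵢ[ℂ] H)} {v v' : H} (hv : v ∈ smoothVectors 𝔤 π)
    (hv' : v' ∈ smoothVectors 𝔤 π) : v + v' ∈ smoothVectors 𝔤 π := by
  intro e he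
  rw [bastianiSmoothOn_iff e.open_target]
  intro n
  simp only [map_add]
  exact ((hv e he).isBastianiC e.open_target n).add ((hv' e he).isBastianiC e.open_target n)

theorem smoothVectors_smul {π : G →* (H ≃ₗᵢ[ℂ] H)} {v : H} (hv : v ∈ smoothVectors 𝔤 π)
    (c : ℂ) : c • v ∈ smoothVectors 𝔤 π := by
  intro e he
  rw [bastianiSmoothOn_iff e.open_target]
  intro n
  simp only [map_smul]
  exact ((hv e he).isBastianiC e.open_target n).clm_apply
    ((c • ContinuousLinearMap.id ℂ H).restrictScalars ℝ)

/-- The derived representation on a smooth vector as a continuous linear map. -/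
theorem exists_dRepReal {exp : 𝔤 → G} (hexp : IsSmoothExp exp) {π : G →* (H ≃ₗᵢ[ℂ] H)} {v : H}
    (hv : v ∈ smoothVectors 𝔤 π) :
    ∃ L : 𝔤 →L[ℝ] H, (∀ x, dRepReal exp π x v = L x) ∧ ∀ (c : ℝ → G) (h : 𝔤), HasVelocity c h →
      Tendsto (fun s : ℝ => s⁻¹ • (π (c s) v - v)) (𝓝[≠] 0) (𝓝 (L h)) := by
  obtain ⟨L, hL⟩ := exists_differential (F := fun g => π g v)
    (chartAt 𝔤 (1 : G)).open_target (chartAt_mem_target 1) (hv _ (chart_mem_atlas 𝔤 1))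
  have h1 : π 1 v = v := by simp
  simp only [h1] at hL
  refine ⟨L, fun x => HasDerivAt.deriv ?_, hL⟩
  rw [hasDerivAt_iff_tendsto_slope_zero]
  simpa [hexp.map_zero] using hL _ x (hexp.hasVelocity x)

/-- The vector π(g) dπ(x)v is the derivative at s = 0 of π(g exp(sx))v, which is smooth jointly in
(g, s). One order of differentiability is spent on `s`. -/
theorem smoothVectors_dRepReal [LocallyConvexSpace ℝ 𝔤] [T2Space 𝔤]
    (hG : IsLocallyConvexLieGroup 𝔤 G) {exp : 𝔤 → G}
    (hexp : IsSmoothExp exp) {π : G →* (H ≃ₗᵢ[ℂ] H)} {v : H} (hv : v ∈ smoothVectors 𝔤 π) (x : 𝔤) :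
    dRepReal exp π x v ∈ smoothVectors 𝔤 π := by
  obtain ⟨L, hL, hLc⟩ := exists_dRepReal hexp hv
  intro e he
  rw [bastianiSmoothOn_iff e.open_target]
  intro n
  set e' := chartAt 𝔤 (1 : G) with he'
  have he'a : e' ∈ atlas 𝔤 G := chart_mem_atlas 𝔤 1
  set Ω : Set (𝔤 × ℝ) := {p | p.1 ∈ e.target ∧ exp (p.2 • x) ∈ e'.source ∧
    e.symm p.1 * exp (p.2 • x) ∈ e.source} with hΩ
  have hexpc : Continuous fun p : 𝔤 × ℝ => exp (p.2 • x) := hexp.continuous.comp (by fun_prop)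
  have hΩo : IsOpen Ω := by
    have h1 : ContinuousOn (fun p : 𝔤 × ℝ => e.symm p.1 * exp (p.2 • x))
        (Prod.fst ⁻¹' e.target) :=
      hG.continuous_mul.comp_continuousOn
        ((e.continuousOn_symm.comp continuousOn_fst fun p hp => hp).prodMk hexpc.continuousOn)
    have h2 := (h1.isOpen_inter_preimage (e.open_target.preimage continuous_fst) e.open_source).inter
      (e'.open_source.preimage hexpc)
    convert! h2 using 1
    ext p
    simp only [hΩ, Set.mem_ofPred_eq, Set.mem_inter_iff, Set.mem_preimage]
    tauto
  have hSo : IsOpen {p : 𝔤 × 𝔤 | p.1 ∈ e.target ∧ p.2 ∈ e'.target ∧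
      e.symm p.1 * e'.symm p.2 ∈ e.source} := by
    have h1 : ContinuousOn (fun p : 𝔤 × 𝔤 => e.symm p.1 * e'.symm p.2)
        (e.target ×ˢ e'.target) :=
      hG.continuous_mul.comp_continuousOn
        ((e.continuousOn_symm.comp continuousOn_fst fun p hp => hp.1).prodMk
          (e'.continuousOn_symm.comp continuousOn_snd fun p hp => hp.2))
    have h2 := h1.isOpen_inter_preimage (e.open_target.prod e'.open_target) e.open_source
    convert! h2 using 1
    ext p
    simp only [Set.mem_ofPred_eq, Set.mem_inter_iff, Set.mem_preimage, Set.mem_prod]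
    tauto
  have hΨ : IsBastianiC (n + 1) (fun p : 𝔤 × ℝ => π (e.symm p.1 * exp (p.2 • x)) v) Ω := by
    have h1 : IsBastianiC (n + 1) (fun p : 𝔤 × ℝ => e' (exp (p.2 • x))) Ω :=
      (((hexp.smooth e' he'a).isBastianiC (e'.open_source.preimage hexp.continuous) (n + 1)).comp_clm
        ((ContinuousLinearMap.snd ℝ 𝔤 ℝ).smulRight x)).mono fun p hp => hp.2.1
    have h2 : IsBastianiC (n + 1) (fun p : 𝔤 × ℝ => (p.1, e' (exp (p.2 • x)))) Ω :=
      (ContinuousLinearMap.isBastianiC (ContinuousLinearMap.fst ℝ 𝔤 ℝ) Ω).prodMk h1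
    have h3 := IsBastianiC.comp hSo ((hG.smooth_mul e he e' he'a e he).isBastianiC hSo (n + 1)) h2
      (fun p hp => ⟨hp.1, e'.map_source hp.2.1, by
        change e.symm p.1 * e'.symm (e' (exp (p.2 • x))) ∈ e.source
        rw [e'.left_inv hp.2.1]
        exact hp.2.2⟩)
    have h4 := IsBastianiC.comp e.open_target ((hv e he).isBastianiC e.open_target (n + 1)) h3
      (fun p hp => e.map_source (by
        rw [e'.left_inv hp.2.1]
        exact hp.2.2))
    refine h4.congr hΩo fun p hp => ?_
    simp only
    rw [e'.left_inv hp.2.1, e.left_inv hp.2.2]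
  obtain ⟨-, df, hd, hn⟩ := hΨ
  have hmem : ∀ z ∈ e.target, (z, (0 : ℝ)) ∈ Ω := fun z hz => by
    refine ⟨hz, ?_, ?_⟩
    · simp only [zero_smul, hexp.map_zero]
      exact mem_chart_source 𝔤 1
    · simpa [hexp.map_zero] using e.map_target hz
  have h5 : IsBastianiC n (fun z : 𝔤 => ((z, (0 : ℝ)), ((0 : 𝔤), (1 : ℝ)))) e.target :=
    (ContinuousLinearMap.isBastianiC (ContinuousLinearMap.inl ℝ 𝔤 ℝ) _).prodMk
      (isBastianiC_const _ _)
  refine (IsBastianiC.comp (hΩo.prod isOpen_univ) hn h5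
    fun z hz => ⟨hmem z hz, Set.mem_univ _⟩).congr e.open_target fun z hz => ?_
  refine tendsto_nhds_unique (hd _ (hmem z hz) (0, 1)) ?_
  have h6 := hLc _ _ (hexp.hasVelocity x)
  rw [← hL] at h6
  let P : H →L[ℝ] H :=
    ((π (e.symm z)).toContinuousLinearEquiv : H →L[ℂ] H).restrictScalars ℝ
  refine ((P.continuous.tendsto _).comp h6).congr fun s => ?_
  rw [Function.comp_apply, map_smul, map_sub]
  simp [hexp.map_zero, P]

theorem smoothVectors_dRep [LocallyConvexSpace ℝ 𝔤] [T2Space 𝔤]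
    (hG : IsLocallyConvexLieGroup 𝔤 G) {exp : 𝔤 → G}
    (hexp : IsSmoothExp exp) {π : G →* (H ≃ₗᵢ[ℂ] H)} {v : H} (hv : v ∈ smoothVectors 𝔤 π)
    (y : Complexification 𝔤) : dRep exp π y v ∈ smoothVectors 𝔤 π :=
  smoothVectors_add (smoothVectors_dRepReal hG hexp hv _)
    (smoothVectors_smul (smoothVectors_dRepReal hG hexp hv _) _)

variable {γ : Multiplicative ℝ →* MulAut G}

/-- Covariance gives π(g) U_t v = U_t π(γ_{-t}(g))v, a composition of smooth maps. The image of a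
chart domain under γ_{-t} need not lie in one chart, so the argument is local. -/
theorem smoothVectors_repU [LocallyConvexSpace ℝ 𝔤] [T2Space 𝔤]
    (hγ : ∀ t, IsLieAut 𝔤 (γ t)) (ρ : G ⋊[γ] Multiplicative ℝ →* (H ≃ₗᵢ[ℂ] H)) {v : H}
    (hv : v ∈ smoothVectors 𝔤 (repG ρ)) (t : ℝ) : repU ρ t v ∈ smoothVectors 𝔤 (repG ρ) := by
  intro e he
  rw [bastianiSmoothOn_iff e.open_target]
  intro n
  simp only [repG_repU]
  set φ := γ (Multiplicative.ofAdd (-t)) with hφ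
  have hφs : IsSmoothSelfMap 𝔤 (fun g => φ g) := (hγ _).1
  let L : H →L[ℝ] H := ((ρ (SemidirectProduct.inr (Multiplicative.ofAdd t))).toContinuousLinearEquiv :
    H →L[ℂ] H).restrictScalars ℝ
  refine IsBastianiC.clm_apply (f := fun x => repG ρ (φ (e.symm x)) v) ?_ L
  refine IsBastianiC.of_local e.open_target fun x₀ hx₀ => ?_
  set e' := chartAt 𝔤 (φ (e.symm x₀)) with he'
  have he'a : e' ∈ atlas 𝔤 G := chart_mem_atlas 𝔤 _
  have hO : IsOpen {x | x ∈ e.target ∧ φ (e.symm x) ∈ e'.source} :=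
    e.isOpen_inter_preimage_symm (e'.open_source.preimage hφs.continuous)
  refine ⟨_, hO, ⟨hx₀, mem_chart_source 𝔤 _⟩, ?_⟩
  have h1 := IsBastianiC.comp e'.open_target ((hv e' he'a).isBastianiC e'.open_target n)
    ((hφs.smooth e he e' he'a).isBastianiC hO n) fun x hx => e'.map_source hx.2
  refine (h1.congr hO fun x hx => ?_).mono Set.inter_subset_right
  rw [e'.left_inv hx.2]

end SmoothVectors

/-! ### The spectral translation formula. -/

section Translation

open scoped FourierTransform InnerProductSpace
open FourierTransform

variable {𝔤 : Type*} [AddCommGroup 𝔤] [Module ℝ 𝔤] [TopologicalSpace 𝔤]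
  [IsTopologicalAddGroup 𝔤] [ContinuousSMul ℝ 𝔤] [LocallyConvexSpace ℝ 𝔤] [T2Space 𝔤]
  {G : Type*} [TopologicalSpace G] [ChartedSpace 𝔤 G] [Group G]
  {H : Type*} [NormedAddCommGroup H] [InnerProductSpace ℂ H]
  {γ : Multiplicative ℝ →* MulAut G}

theorem inner_repG_right {G : Type*} [Group G] (π : G →* (H ≃ₗᵢ[ℂ] H)) (g : G) (u v : H) :
    ⟪u, π g v⟫_ℂ = ⟪π g⁻¹ u, v⟫_ℂ := by
  rw [← (π g).inner_map_map (π g⁻¹ u) v]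
  simp

/-- The difference quotients agree before the limit: U_t π(exp(sx)) = π(γ_t(exp(sx))) U_t, and the
unitary π(γ_t(exp(sx))) moves to the left slot as its inverse. -/
theorem inner_repU_dRepReal {exp : 𝔤 → G} (hexp : IsSmoothExp exp) (hγ : ∀ t, IsLieAut 𝔤 (γ t))
    (ρ : G ⋊[γ] Multiplicative ℝ →* (H ≃ₗᵢ[ℂ] H)) {u v : H} (hu : u ∈ smoothVectors 𝔤 (repG ρ))
    (hv : v ∈ smoothVectors 𝔤 (repG ρ)) (t : ℝ) (x : 𝔤) :
    ⟪u, repU ρ t (dRepReal exp (repG ρ) x v)⟫_ℂ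
      = -⟪dRepReal exp (repG ρ) (lieMap (γ (Multiplicative.ofAdd t)) x) u, repU ρ t v⟫_ℂ := by
  obtain ⟨L, hL, hLc⟩ := exists_dRepReal hexp hv
  obtain ⟨L', hL', hLc'⟩ := exists_dRepReal hexp hu
  obtain ⟨M, hM, hMc⟩ := exists_lieMap (hγ (Multiplicative.ofAdd t))
  obtain ⟨T, hT⟩ := repU_linear ρ t
  set φ := γ (Multiplicative.ofAdd t) with hφ
  have h1 : Tendsto (fun s : ℝ => ⟪u, T (s⁻¹ • (repG ρ (exp (s • x)) v - v))⟫_ℂ) (𝓝[≠] 0)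
      (𝓝 ⟪u, T (L x)⟫_ℂ) :=
    tendsto_const_nhds.inner ((T.continuous.tendsto _).comp (hLc _ _ (hexp.hasVelocity x)))
  have h2 : Tendsto (fun s : ℝ => ⟪s⁻¹ • (repG ρ (φ (exp (s • (-x)))) u - u), T v⟫_ℂ) (𝓝[≠] 0)
      (𝓝 ⟪L' (M (-x)), T v⟫_ℂ) :=
    (hLc' _ _ (hMc _ _ (hexp.hasVelocity (-x)))).inner tendsto_const_nhds
  rw [hL, hT, hT, hM, hL', ← inner_neg_left, ← map_neg, ← map_neg]
  refine tendsto_nhds_unique h1 (h2.congr fun s => ?_)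
  have h3 : T (repG ρ (exp (s • x)) v) = repG ρ (φ (exp (s • x))) (T v) := by
    rw [← hT, ← hT, repU_repG]
  rw [map_real_smul T T.continuous, map_sub, h3, ← Complex.coe_smul, ← Complex.coe_smul,
    inner_smul_left, inner_smul_right, Complex.conj_ofReal, inner_sub_left, inner_sub_right,
    inner_repG_right, smul_neg, hexp.map_neg, map_inv]

/-- The pairing of `U_t dπ(y) v` with a smooth vector `u`, expressed through the adjoint
of `dπ(α_t y)` on `u`. -/
theorem exists_adjoint_dRep {exp : 𝔤 → G} (hexp : IsSmoothExp exp) (hγ : ∀ t, IsLieAut 𝔤 (γ t))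
    (ρ : G ⋊[γ] Multiplicative ℝ →* (H ≃ₗᵢ[ℂ] H)) {u : H}
    (hu : u ∈ smoothVectors 𝔤 (repG ρ)) :
    ∃ T : Complexification 𝔤 →ₛₗ[starRingEnd ℂ] H, Continuous T ∧
      ∀ v ∈ smoothVectors 𝔤 (repG ρ), ∀ (t : ℝ) (y : Complexification 𝔤),
        ⟪u, repU ρ t (dRep exp (repG ρ) y v)⟫_ℂ
          = ⟪T (complexAction 𝔤 γ t y), repU ρ t v⟫_ℂ := by
  obtain ⟨L, hL, -⟩ := exists_dRepReal hexp hu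
  -- On smooth vectors the formal adjoint of dπ(a + ib) is -dπ(a - ib), which dictates this
  -- antilinear map.
  refine ⟨⟨⟨fun y => -L y.re + Complex.I • L y.im, fun x y => ?_⟩, fun c y => ?_⟩, ?_,
    fun v hv t y => ?_⟩
  · simp only [Complexification.re_add, Complexification.im_add, map_add, smul_add]
    abel
  · simp only [Complexification.re_smul, Complexification.im_smul, map_add, map_sub, map_smul,
      ← Complex.coe_smul]
    have hc : (starRingEnd ℂ) c = (c.re : ℂ) - c.im * Complex.I := by
      apply Complex.ext <;> simp
    rw [hc]
    have hI : ∀ z : H, Complex.I • Complex.I • z = -z := fun z => by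
      rw [smul_smul, Complex.I_mul_I, neg_one_smul]
    calc _ = ((c.re : ℂ) - c.im * Complex.I) • (-L y.re + Complex.I • L y.im)
          + (c.im : ℂ) • (Complex.I • Complex.I • L y.im + L y.im) := by module
      _ = _ := by rw [hI, neg_add_cancel, smul_zero, add_zero]
  · exact (L.continuous.comp Complexification.continuous_re).neg.add
      ((L.continuous.comp Complexification.continuous_im).const_smul Complex.I)
  · obtain ⟨T, hT⟩ := repU_linear ρ t
    have h1 := inner_repU_dRepReal hexp hγ ρ hu hv t y.re
    have h2 := inner_repU_dRepReal hexp hγ ρ hu hv t y.im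
    rw [hT, hL] at h1 h2
    rw [dRep, hT, map_add, map_smul, inner_add_right, inner_smul_right, h1, h2]
    change _ = ⟪-L (lieMap _ y.re) + Complex.I • L (lieMap _ y.im), _⟫_ℂ
    rw [inner_add_left, inner_neg_left, inner_smul_left, Complex.conj_I]
    ring

/-- Both parts of the theorem reduce to this: of α only polynomial bounds on the orbit of `y` and
the Fourier support of its matrix coefficients are needed. -/
theorem dRep_mem_smoothSpectralSubspace [CompleteSpace H] (hG : IsLocallyConvexLieGroup 𝔤 G)
    {exp : 𝔤 → G} (hexp : IsSmoothExp exp) (hγ : ∀ t, IsLieAut 𝔤 (γ t))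
    {ρ : G ⋊[γ] Multiplicative ℝ →* (H ≃ₗᵢ[ℂ] H)} (hρ : IsContinuousUnitaryRep ρ) {E F : Set ℝ}
    {y : Complexification 𝔤} (hcont : Continuous fun t => complexAction 𝔤 γ t y)
    (hbd : ∀ p : Seminorm ℂ (Complexification 𝔤), Continuous p →
      ∃ (C : ℝ) (N : ℕ), ∀ t, p (complexAction 𝔤 γ t y) ≤ C * (1 + |t|) ^ N)
    (hy : ∀ l : Complexification 𝔤 →L[ℂ] ℂ,
      FourierVanishes (fun t => l (complexAction 𝔤 γ t y)) (closure (twoPi ⁻¹' E))ᶜ)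
    {v : H} (hv : v ∈ smoothSpectralSubspace 𝔤 ρ F) :
    dRep exp (repG ρ) y v ∈ smoothSpectralSubspace 𝔤 ρ (E + F) := by
  obtain ⟨hvs, hvF⟩ := hv
  have hw : dRep exp (repG ρ) y v ∈ smoothVectors 𝔤 (repG ρ) := smoothVectors_dRep hG hexp hvs y
  refine ⟨hw, fun s₀ hs₀ => ?_⟩
  set w := dRep exp (repG ρ) y v with hwdef
  by_contra hn
  have hU := hρ.continuous_repU
  obtain ⟨ξ, rfl⟩ : ∃ ξ, twoPi ξ = s₀ := twoPi.surjective s₀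
  have hξ : (closure (twoPi ⁻¹' E + twoPi ⁻¹' F))ᶜ ∈ 𝓝 ξ := by
    refine isClosed_closure.isOpen_compl.mem_nhds fun h => hn ?_
    have hsub : twoPi ⁻¹' E + twoPi ⁻¹' F ⊆ twoPi ⁻¹' (E + F) := by
      rintro _ ⟨a, ha, b, hb, rfl⟩
      refine ⟨_, ha, _, hb, ?_⟩
      simp only [twoPi_apply]
      ring
    have h1 := closure_mono hsub h
    rwa [← twoPi.preimage_closure] at h1
  obtain ⟨k, hk, hkO, hk1⟩ := exists_schwartz_tsupport_subset hξ
  have hpair : ∀ u ∈ smoothVectors 𝔤 (repG ρ), ∫ t, 𝓕 k t * ⟪u, repU ρ t w⟫_ℂ = 0 := by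
    intro u hu
    obtain ⟨T, hTc, hT⟩ := exists_adjoint_dRep hexp hγ ρ hu
    simp only [hwdef, hT v hvs]
    obtain ⟨C, N, hC⟩ := hbd ((normSeminorm ℂ H).comp T) (continuous_norm.comp hTc)
    -- In the second variable the growth bound is just the constant norm of U_t v.
    refine FourierVanishes.diagonal
      (Φ := fun p : ℝ × ℝ => ⟪T (complexAction 𝔤 γ p.1 y), repU ρ p.2 v⟫_ℂ) (C := C * ‖v‖) (N := N)
      (((hTc.comp hcont).comp continuous_fst).inner ((hU v).comp continuous_snd))
      (fun p => ?_) (fun t => ?_) (fun s => ?_) k hk hkO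
    · calc _ ≤ ‖T (complexAction 𝔤 γ p.1 y)‖ * ‖repU ρ p.2 v‖ := norm_inner_le_norm _ _
        _ ≤ (C * (1 + |p.1|) ^ N) * ‖v‖ := by
          rw [norm_repU]
          gcongr
          exact hC p.1
        _ = _ := by ring
    · let l : Complexification 𝔤 →L[ℂ] ℂ :=
        ⟨⟨⟨fun x => ⟪T x, repU ρ t v⟫_ℂ, fun a b => by rw [map_add, inner_add_left]⟩, fun c a => by
          change ⟪T (c • a), _⟫_ℂ = c * ⟪T a, _⟫_ℂ
          rw [T.map_smulₛₗ, inner_smul_left, Complex.conj_conj]⟩,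
          hTc.inner continuous_const⟩
      exact hy l
    · refine FourierVanishes.of_mem_spectralSubspace_integrable (repU_linear ρ) (repU_add ρ) (hU v)
        hvF (innerSL ℂ (T (complexAction 𝔤 γ s y)))
        (B := ‖T (complexAction 𝔤 γ s y)‖ * ‖v‖) fun t => ?_
      rw [innerSL_apply_apply, ← norm_repU ρ t v]
      exact norm_inner_le_norm _ _
  have hint : Integrable fun t => 𝓕 k t • repU ρ t w :=
    (𝓕 k).integrable.smul_bdd ‖w‖ (hU w).aestronglyMeasurable
      (ae_of_all _ fun t => (norm_repU ρ t w).le)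
  have hinner : ∀ u : H, ⟪u, ∫ t, 𝓕 k t • repU ρ t w⟫_ℂ = ∫ t, 𝓕 k t * ⟪u, repU ρ t w⟫_ℂ := by
    intro u
    rw [← integral_inner hint]
    simp only [inner_smul_right]
  set I := ∫ t, 𝓕 k t • repU ρ t w with hI
  have hI0 : I = 0 := by
    have horth : ∀ u ∈ smoothVectors 𝔤 (repG ρ), ⟪I, u⟫_ℂ = 0 := fun u hu => by
      rw [← inner_conj_symm, hinner, hpair u hu, map_zero]
    -- ⟨I, I⟩ is the integral of 𝓕 k(t) ⟨I, U_t w⟩, and each U_t w is a smooth vector.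
    rw [← inner_self_eq_zero (𝕜 := ℂ), hinner]
    simp [horth _ (smoothVectors_repU hγ ρ hw _)]
  have hzero : HasWeakIntegral (fun t => 𝓕 k t • repU ρ t w) 0 := by
    intro l
    refine ⟨l.integrable_comp hint, ?_⟩
    rw [l.integral_comp_comm hint, ← hI, hI0]
  have h1 := hs₀ (fun t => 𝓕 k t) (𝓕 k).integrable hzero
  rw [twoPi_apply, hat_eq_fourierInv] at h1
  have h2 : 𝓕⁻ (𝓕 k) ξ = 1 := by rw [FourierTransform.fourierInv_fourier_eq, hk1]
  rw [SchwartzMap.fourierInv_coe] at h2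
  exact one_ne_zero (h2.symm.trans h1)

end Translation

end SpecTransl

open SpecTransl in
theorem theorem3p1
    {𝔤 : Type*} [AddCommGroup 𝔤] [Module ℝ 𝔤] [UniformSpace 𝔤] [IsUniformAddGroup 𝔤]
    [ContinuousSMul ℝ 𝔤] [LocallyConvexSpace ℝ 𝔤] [T2Space 𝔤] [CompleteSpace 𝔤]
    {G : Type*} [TopologicalSpace G] [T2Space G] [ChartedSpace 𝔤 G] [Group G]
    (hG : IsLocallyConvexLieGroup 𝔤 G)
    (exp : 𝔤 → G) (hexp : IsSmoothExp exp)
    (γ : Multiplicative ℝ →* MulAut G)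
    (hγ_aut : ∀ t, IsLieAut 𝔤 (γ t))
    (hγ_cont : Continuous fun p : ℝ × G => γ (Multiplicative.ofAdd p.1) p.2)
    (hα_cont : Continuous fun p : ℝ × Complexification 𝔤 => complexAction 𝔤 γ p.1 p.2)
    {H : Type*} [NormedAddCommGroup H] [InnerProductSpace ℂ H] [CompleteSpace H]
    (ρ : G ⋊[γ] Multiplicative ℝ →* (H ≃ₗᵢ[ℂ] H)) (hρ : IsContinuousUnitaryRep ρ) :
    (IsEquicontinuous (complexAction 𝔤 γ) →
      ∀ E F : Set ℝ, ∀ y ∈ spectralSubspace L1Functions (complexAction 𝔤 γ) E,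
        ∀ v ∈ smoothSpectralSubspace 𝔤 ρ F,
          dRep exp (repG ρ) y v ∈ smoothSpectralSubspace 𝔤 ρ (E + F)) ∧
    (IsPolynomiallyBounded (complexAction 𝔤 γ) →
      ∀ E F : Set ℝ, ∀ y ∈ spectralSubspace SchwartzFunctions (complexAction 𝔤 γ) E,
        ∀ v ∈ smoothSpectralSubspace 𝔤 ρ F,
          dRep exp (repG ρ) y v ∈ smoothSpectralSubspace 𝔤 ρ (E + F)) := by
  have hlin := complexAction_linear hγ_aut
  have hadd := complexAction_add hγ_aut
  have hcont : ∀ y, Continuous fun t => complexAction 𝔤 γ t y := fun y =>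
    hα_cont.comp (f := fun t : ℝ => (t, y)) (by fun_prop)
  have hsemi : ∀ l : Complexification 𝔤 →L[ℂ] ℂ,
      Continuous ((normSeminorm ℂ ℂ).comp l.toLinearMap) := fun l =>
    continuous_norm.comp l.continuous
  refine ⟨fun hα E F y hy v hv => ?_, fun hα E F y hy v hv => ?_⟩
  · refine dRep_mem_smoothSpectralSubspace hG hexp hγ_aut hρ (hcont y) (fun p hp => ?_)
      (fun l => ?_) hv
    · obtain ⟨C, hC⟩ := hα.exists_bound hlin p hp y
      exact ⟨C, 0, by simpa using hC⟩
    · obtain ⟨C, hC⟩ := hα.exists_bound hlin _ (hsemi l) y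
      exact FourierVanishes.of_mem_spectralSubspace_integrable hlin hadd (hcont y) hy l hC
  · refine dRep_mem_smoothSpectralSubspace hG hexp hγ_aut hρ (hcont y)
      (fun p hp => hα.exists_bound hlin p hp y) (fun l => ?_) hv
    exact FourierVanishes.of_mem_spectralSubspace_schwartz hlin hadd hy l
      ⟨l.continuous.comp (hcont y), hα.exists_bound hlin _ (hsemi l) y⟩
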